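/- Consider the nonstochastic $K$-armed bandit with $K\ge 2$ actions and feedback delay $d\ge 0$. Loss vectors $\ell_1,\ell_2,\dots\in[0,1]^K$ are fixed in advance and hidden from the player. In each round $t=1,2,\dots$ the player draws an action $I_t\in\{1,\dots,K\}$ from a distribution depending on its past actions and on the losses observed so far, and suffers the loss $\ell_t(I_t)$; at the end of round $t$ it observes $\ell_{t-d}(I_{t-d})$ if $t>d$, and nothing otherwise. The regret is $$R_T=\mathbb E\Bigl[\sum_{t=1}^T\ell_t(I_t)\Bigr]-\min_{1\le i\le K}\sum_{t=1}^T\ell_t(i),$$ and the minimax regret $R^*_T(K,d)$ is the infimum over all randomized strategies of the player of the supremum of $R_T$ over all loss sequences. Then $R^*_T(K,d)$ is of order $\sqrt{(K+d)T}$ up to logarithmic factors (and up to the trivial bound $T$). Precisely, there are universal constants $c,C>0$ such that for all integers $K\ge 2$, $d\ge 0$, $T\ge 0$, $$c\,\min\bigl\{T,\sqrt{(K+d)T}\bigr\}\;\le\;R^*_T(K,d)\;\le\;C\,\min\bigl\{T,\sqrt{(K+d)T\ln K}\bigr\};$$ in particular $c\sqrt{(K+d)T}\le R^*_T(K,d)\le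 C\sqrt{(K+d)T\ln K}$ whenever $T\ge K+d$. Moreover, for all such $K,d,T$ there is a learning rate $\eta>0$ (depending only on $K,d,T$) for which Exp3 with delay satisfies $R_T\le C\bigl(d+\sqrt{(K+d)T\ln K}\bigr)$ for every loss sequence. This is the strategy that draws $I_t$ from $p_t(i)=w_t(i)/\sum_j w_t(j)$, where $w_1(i)=1$ and $w_{t+1}(i)=p_t(i)\exp(-\eta\,\widehat\ell_t(i))$, with $\widehat\ell_t(i)=\frac{\ell_{t-d}(i)}{p_{t-d}(i)}\mathbf 1\{I_{t-d}=i\}$ if $t>d$ and $\widehat\ell_t(i)=0$ otherwise. -/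

import Mathlib

namespace DelayedBandit

/-- A randomized strategy for the `K`-armed bandit in which losses are revealed with delay `d`.
Rounds are numbered from `0`. Before round `t` is played the strategy knows its own actions in
rounds `0, …, t - 1` and the losses suffered in the rounds `s` with `s + d < t`, that is in rounds
`0, …, t - d - 1` (none if `t ≤ d`). From these it computes the distribution of the next action. -/
abbrev Strategy (K d : ℕ) : Type :=
  (t : ℕ) → (Fin t → Fin K) → (Fin (t - d) → ℝ) → stdSimplex ℝ (Fin K)

/-- Loss sequences: `ℓ t i ∈ [0, 1]` is the loss of action `i` in round `t`. -/
abbrev LossSeq (K : ℕ) : Type := ℕ → Fin K → Set.Icc (0 : ℝ) 1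

variable {K d : ℕ}

/-- The conditional probability with which the strategy plays `a t` in round `t`, given that its
earlier actions were `a 0, …, a (t - 1)`. -/
noncomputable def stepProb (π : Strategy K d) (ℓ : LossSeq K) {T : ℕ} (a : Fin T → Fin K)
    (t : Fin T) : ℝ :=
  (π t (fun s => a ⟨s, s.isLt.trans t.isLt⟩)
    (fun s => ℓ s (a ⟨s, (s.isLt.trans_le (Nat.sub_le _ _)).trans t.isLt⟩)) : Fin K → ℝ) (a t)

/-- The probability that the actions of the first `T` rounds are `a`, when the losses are `ℓ`. -/
noncomputable def actionProb (π : Strategy K d) (ℓ : LossSeq K) {T : ℕ} (a : Fin T → Fin K) : ℝ :=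
  ∏ t, stepProb π ℓ a t

/-- The expected cumulative loss `𝔼 [∑ ℓ_t(I_t)]` over the first `T` rounds. -/
noncomputable def expectedLoss (π : Strategy K d) (ℓ : LossSeq K) (T : ℕ) : ℝ :=
  ∑ a : Fin T → Fin K, actionProb π ℓ a * ∑ t : Fin T, (ℓ t (a t) : ℝ)

/-- The regret over `T` rounds against the best fixed action. -/
noncomputable def regret (π : Strategy K d) (ℓ : LossSeq K) (T : ℕ) : ℝ :=
  expectedLoss π ℓ T - ⨅ i : Fin K, ∑ t ∈ Finset.range T, (ℓ t i : ℝ)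

/-- The minimax regret over `T` rounds with `K` actions and delay `d`. -/
noncomputable def minimaxRegret (K d T : ℕ) : ℝ :=
  ⨅ π : Strategy K d, ⨆ ℓ : LossSeq K, regret π ℓ T

/-- The weights of Exp3 with learning rate `η` and delay `d`: `w₀ = 1` and
`w_{t+1}(i) = p_t(i) exp (-η ℓ̂_t(i))`, where `p_t = w_t / ∑ j, w_t(j)`, and where the loss
estimate `ℓ̂_t(i)` is `y (t - d) i / p_{t-d}(i)` if `t ≥ d` and `0` otherwise. Here `y s i` stands
for the loss of round `s` if action `i` was played in round `s`, and for `0` otherwise. -/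
noncomputable def exp3Weight (d : ℕ) (η : ℝ) (y : ℕ → Fin K → ℝ) : ℕ → Fin K → ℝ
  | 0 => fun _ => 1
  | t + 1 => fun i =>
      exp3Weight d η y t i / (∑ j, exp3Weight d η y t j) *
        Real.exp (-η * (if d ≤ t then
          y (t - d) i / (exp3Weight d η y (t - d) i / ∑ j, exp3Weight d η y (t - d) j) else 0))
  termination_by t => t
  decreasing_by all_goals omega

theorem exp3Weight_pos (d : ℕ) (η : ℝ) (y : ℕ → Fin K → ℝ) (t : ℕ) (i : Fin K) :
    0 < exp3Weight d η y t i := by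
  induction t generalizing i with
  | zero => simp [exp3Weight]
  | succ t ih =>
    rw [exp3Weight]
    exact mul_pos (div_pos (ih i) (Finset.sum_pos (fun j _ => ih j) ⟨i, Finset.mem_univ i⟩))
      (Real.exp_pos _)

/-- Exp3 with learning rate `η`, each loss being used as soon as it is revealed. -/
noncomputable def exp3 (hK : 0 < K) (d : ℕ) (η : ℝ) : Strategy K d := fun t a x =>
  let y : ℕ → Fin K → ℝ := fun s i =>
    if h : s < t - d then
      (if a ⟨s, h.trans_le (Nat.sub_le _ _)⟩ = i then x ⟨s, h⟩ else 0)
    else 0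
  ⟨fun i => exp3Weight d η y t i / ∑ j, exp3Weight d η y t j, by
    have hpos : 0 < ∑ j, exp3Weight d η y t j :=
      Finset.sum_pos (fun j _ => exp3Weight_pos d η y t j) ⟨⟨0, hK⟩, Finset.mem_univ _⟩
    refine ⟨fun i => (div_pos (exp3Weight_pos d η y t i) hpos).le, ?_⟩
    rw [← Finset.sum_div, div_self hpos.ne']⟩

end DelayedBandit

/-! Upper bound. Each normalisation step of Exp3 changes the distribution little. If 4η(d+1) ≤ 1,
then p_{t+1}(1 - 2η) ≤ p_t, so a delay of d rounds at most doubles each probability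
(`exp3Prob_add_le`). The estimate of round t is applied at round t+d, so the potential log p(k)
controls Σ p_{t+d}·ℓ̂_t (`sum_exp3Prob_mul_lossEst_le_add`). By the doubling, its second-order term
is at most 2η Σ_i ℓ̂_t(i), of mean at most 2ηK. Since p_{t+d} is determined by the actions before
round t, ℓ̂_t is unbiased even against it (`seqExp_mul_lossEst`). Replacing p_t by p_{t+d} costs at
most 2ηd per round (`sum_exp3Prob_mul_le`). Together this gives log K/η + 2η(K+d)T
(`regret_exp3_le`), and η is then tuned.

Lower bound. The two sources of difficulty are treated separately, each by averaging over random
losses. For √(KT), all losses are fair bits except those of one action, which has an advantage ε. An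
action rarely played under fair bits cannot be detected, by Pinsker's inequality
(`seqExp_playCount_single_le`). For √((d+1)T), the losses are constant on blocks of length L ≤ d+1
with an independent random sign per block. The sign is never seen while it matters, so every
strategy pays T/2 on average (`seqExp_expectedLoss_blockLoss`), while the better of two actions
gains from the fluctuation of the signs (`sqrt_le_seqExp_abs_signSum`). Subadditivity of the square
root combines the two bounds. -/

namespace DelayedBandit

/-! ### Finite sequential laws and their expectations -/

section SequentialLaw

variable {α : Type*}

/-- The history before round `t`. -/
def past {T : ℕ} (a : Fin T → α) (t : Fin T) : Fin t → α :=
  fun s => a ⟨s, s.isLt.trans t.isLt⟩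

/-- The probability of the path `a` when `q n h` is the law of the entry number `n` given the
earlier entries `h`. -/
noncomputable def seqLaw (q : (n : ℕ) → (Fin n → α) → α → ℝ) {T : ℕ} (a : Fin T → α) : ℝ :=
  ∏ t : Fin T, q t (past a t) (a t)

/-- Expectation with respect to `seqLaw q` on paths of length `T`. -/
noncomputable def seqExp [Fintype α] (q : (n : ℕ) → (Fin n → α) → α → ℝ) (T : ℕ)
    (f : (Fin T → α) → ℝ) : ℝ :=
  ∑ a, seqLaw q a * f a

@[simp]
theorem past_snoc_last {n : ℕ} (a : Fin n → α) (x : α) :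
    past (Fin.snoc a x : Fin (n + 1) → α) (Fin.last n) = a := by
  funext s
  exact Fin.snoc_castSucc (α := fun _ => α) x a s

@[simp]
theorem past_snoc_castSucc {n : ℕ} (a : Fin n → α) (x : α) (t : Fin n) :
    past (Fin.snoc a x : Fin (n + 1) → α) t.castSucc = past a t := by
  funext s
  exact Fin.snoc_castSucc (α := fun _ => α) x a ⟨s, s.isLt.trans t.isLt⟩

theorem seqLaw_snoc (q : (n : ℕ) → (Fin n → α) → α → ℝ) {n : ℕ} (a : Fin n → α) (x : α) :
    seqLaw q (Fin.snoc a x : Fin (n + 1) → α) = seqLaw q a * q n a x := by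
  unfold seqLaw
  rw [Fin.prod_univ_castSucc]
  congr 1
  · refine Finset.prod_congr rfl fun t _ => ?_
    rw [past_snoc_castSucc, Fin.snoc_castSucc]
    rfl
  · rw [past_snoc_last, Fin.snoc_last]
    rfl

theorem seqLaw_nonneg {q : (n : ℕ) → (Fin n → α) → α → ℝ} (hq : ∀ n h x, 0 ≤ q n h x) {T : ℕ}
    (a : Fin T → α) : 0 ≤ seqLaw q a :=
  Finset.prod_nonneg fun _ _ => hq _ _ _

variable [Fintype α] {q : (n : ℕ) → (Fin n → α) → α → ℝ}

theorem seqExp_succ (n : ℕ) (f : (Fin (n + 1) → α) → ℝ) :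
    seqExp q (n + 1) f = seqExp q n fun a => ∑ x, q n a x * f (Fin.snoc a x) := by
  unfold seqExp
  rw [← (Fin.snocEquiv fun _ => α).sum_comp, Fintype.sum_prod_type_right]
  refine Finset.sum_congr rfl fun a _ => ?_
  rw [Finset.mul_sum]
  refine Finset.sum_congr rfl fun x _ => ?_
  change seqLaw q (Fin.snoc a x : Fin (n + 1) → α) * f (Fin.snoc a x) = _
  rw [seqLaw_snoc, mul_assoc]

theorem seqExp_mono (hq : ∀ n h x, 0 ≤ q n h x) {T : ℕ} {f g : (Fin T → α) → ℝ}
    (h : ∀ a, f a ≤ g a) : seqExp q T f ≤ seqExp q T g :=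
  Finset.sum_le_sum fun a _ => mul_le_mul_of_nonneg_left (h a) (seqLaw_nonneg hq a)

theorem seqExp_add {T : ℕ} (f g : (Fin T → α) → ℝ) :
    seqExp q T (fun a => f a + g a) = seqExp q T f + seqExp q T g := by
  simp only [seqExp, mul_add, Finset.sum_add_distrib]

theorem seqExp_sub {T : ℕ} (f g : (Fin T → α) → ℝ) :
    seqExp q T (fun a => f a - g a) = seqExp q T f - seqExp q T g := by
  simp only [seqExp, mul_sub, Finset.sum_sub_distrib]

theorem seqExp_const_mul {T : ℕ} (c : ℝ) (f : (Fin T → α) → ℝ) :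
    seqExp q T (fun a => c * f a) = c * seqExp q T f := by
  simp only [seqExp, Finset.mul_sum, mul_left_comm]

theorem seqExp_sum {ι : Type*} (s : Finset ι) {T : ℕ} (f : ι → (Fin T → α) → ℝ) :
    seqExp q T (fun a => ∑ i ∈ s, f i a) = ∑ i ∈ s, seqExp q T (f i) := by
  simp only [seqExp, Finset.mul_sum]
  exact Finset.sum_comm

theorem seqExp_const (hq : ∀ n h, ∑ x, q n h x = 1) (T : ℕ) (c : ℝ) :
    seqExp q T (fun _ => c) = c := by
  induction T with
  | zero => simp [seqExp, seqLaw]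
  | succ n ih =>
    rw [seqExp_succ]
    simpa only [← Finset.sum_mul, hq, one_mul] using ih

theorem sum_seqLaw (hq : ∀ n h, ∑ x, q n h x = 1) (T : ℕ) :
    ∑ a : Fin T → α, seqLaw q a = 1 := by
  simpa [seqExp] using seqExp_const hq T 1

/-- Averaging out the rounds after `t`. -/
theorem seqExp_past_apply (hq : ∀ n h, ∑ x, q n h x = 1) {T : ℕ} (t : Fin T)
    (g : (n : ℕ) → (Fin n → α) → α → ℝ) :
    seqExp q T (fun a => g t (past a t) (a t)) =
      seqExp q t fun h => ∑ x, q t h x * g t h x := by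
  induction T with
  | zero => exact t.elim0
  | succ n ih =>
    rw [seqExp_succ]
    induction t using Fin.lastCases with
    | last =>
      simp only [past_snoc_last, Fin.snoc_last]
      rfl
    | cast t =>
      simp only [past_snoc_castSucc, Fin.snoc_castSucc, ← Finset.sum_mul, hq, one_mul]
      exact ih t

/-- The tower property for the entry of round `t`. -/
theorem seqExp_condExp (hq : ∀ n h, ∑ x, q n h x = 1) {T : ℕ} (t : Fin T)
    (g : (n : ℕ) → (Fin n → α) → α → ℝ) :
    seqExp q T (fun a => g t (past a t) (a t)) =
      seqExp q T fun a => ∑ x, q t (past a t) x * g t (past a t) x := by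
  rw [seqExp_past_apply hq, seqExp_past_apply hq t fun n h _ => ∑ x, q n h x * g n h x]
  simp only [← Finset.sum_mul, hq, one_mul]

end SequentialLaw

/-! ### Regret and minimax regret: general bounds -/

variable {K d : ℕ}

/-- The law of the action of round `n` given the earlier actions. -/
noncomputable def actionKernel (π : Strategy K d) (ℓ : LossSeq K) (n : ℕ) (h : Fin n → Fin K)
    (j : Fin K) : ℝ :=
  (π n h fun s => ℓ s (h ⟨s, s.isLt.trans_le (Nat.sub_le _ _)⟩) : Fin K → ℝ) j

theorem actionKernel_nonneg (π : Strategy K d) (ℓ : LossSeq K) (n : ℕ) (h : Fin n → Fin K)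
    (j : Fin K) : 0 ≤ actionKernel π ℓ n h j :=
  (π n h _).2.1 j

theorem sum_actionKernel (π : Strategy K d) (ℓ : LossSeq K) (n : ℕ) (h : Fin n → Fin K) :
    ∑ j, actionKernel π ℓ n h j = 1 :=
  (π n h _).2.2

theorem expectedLoss_eq_seqExp (π : Strategy K d) (ℓ : LossSeq K) (T : ℕ) :
    expectedLoss π ℓ T =
      seqExp (actionKernel π ℓ) T fun a => ∑ t : Fin T, (ℓ t (a t) : ℝ) :=
  rfl

theorem expectedLoss_eq_sum (π : Strategy K d) (ℓ : LossSeq K) (T : ℕ) :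
    expectedLoss π ℓ T =
      ∑ t : Fin T, seqExp (actionKernel π ℓ) t fun h => ∑ j, actionKernel π ℓ t h j * ℓ t j := by
  rw [expectedLoss_eq_seqExp, seqExp_sum]
  exact Finset.sum_congr rfl fun t _ =>
    seqExp_past_apply (sum_actionKernel π ℓ) t fun n _ j => (ℓ n j : ℝ)

theorem sum_loss_nonneg (ℓ : LossSeq K) (T : ℕ) (i : Fin K) :
    0 ≤ ∑ t ∈ Finset.range T, (ℓ t i : ℝ) :=
  Finset.sum_nonneg fun t _ => (ℓ t i).2.1

theorem iInf_sum_loss_le (ℓ : LossSeq K) (T : ℕ) (i : Fin K) :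
    ⨅ i : Fin K, ∑ t ∈ Finset.range T, (ℓ t i : ℝ) ≤ ∑ t ∈ Finset.range T, (ℓ t i : ℝ) :=
  ciInf_le ⟨0, by rintro _ ⟨j, rfl⟩; exact sum_loss_nonneg ℓ T j⟩ i

theorem regret_le_length (π : Strategy K d) (ℓ : LossSeq K) (T : ℕ) : regret π ℓ T ≤ T := by
  have h₁ : expectedLoss π ℓ T ≤ T := by
    rw [expectedLoss_eq_seqExp, ← seqExp_const (sum_actionKernel π ℓ) T (T : ℝ)]
    refine seqExp_mono (actionKernel_nonneg π ℓ) fun a => ?_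
    simpa using Finset.sum_le_card_nsmul Finset.univ (fun t : Fin T => (ℓ t (a t) : ℝ)) 1
      fun t _ => (ℓ t (a t)).2.2
  have h₂ : 0 ≤ ⨅ i : Fin K, ∑ t ∈ Finset.range T, (ℓ t i : ℝ) :=
    Real.iInf_nonneg (sum_loss_nonneg ℓ T)
  unfold regret
  linarith

/-- A real `⨆` is 0 by default on an unbounded family; boundedness makes the supremum in
`minimaxRegret` a genuine one. -/
theorem bddAbove_regret (π : Strategy K d) (T : ℕ) :
    BddAbove (Set.range fun ℓ : LossSeq K => regret π ℓ T) :=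
  ⟨T, by rintro _ ⟨ℓ, rfl⟩; exact regret_le_length π ℓ T⟩

theorem regret_zero_loss (π : Strategy K d) (T : ℕ) : regret π (fun _ _ => 0) T = 0 := by
  simp [regret, expectedLoss]

theorem iSup_regret_nonneg (π : Strategy K d) (T : ℕ) :
    0 ≤ ⨆ ℓ : LossSeq K, regret π ℓ T :=
  (regret_zero_loss π T).ge.trans (le_ciSup (bddAbove_regret π T) _)

theorem minimaxRegret_le (π : Strategy K d) {T : ℕ} {x : ℝ}
    (h : ∀ ℓ : LossSeq K, regret π ℓ T ≤ x) : minimaxRegret K d T ≤ x :=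
  have : Nonempty (LossSeq K) := ⟨fun _ _ => 0⟩
  (ciInf_le ⟨0, by rintro _ ⟨π, rfl⟩; exact iSup_regret_nonneg π T⟩ π).trans (ciSup_le h)

/-- The minimax regret is at least the average regret against random losses. -/
theorem le_minimaxRegret_of_average (hK : 0 < K) {T : ℕ} {x : ℝ}
    (h : ∀ π : Strategy K d, ∃ (Ω : Type) (_ : Fintype Ω) (w : Ω → ℝ) (ℓ : Ω → LossSeq K),
      (∀ ω, 0 ≤ w ω) ∧ ∑ ω, w ω = 1 ∧ x ≤ ∑ ω, w ω * regret π (ℓ ω) T) :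
    x ≤ minimaxRegret K d T := by
  have : Nonempty (Strategy K d) := ⟨exp3 hK d 1⟩
  refine le_ciInf fun π => ?_
  obtain ⟨Ω, _, w, ℓ, hw, hw1, hx⟩ := h π
  refine hx.trans ?_
  calc ∑ ω, w ω * regret π (ℓ ω) T
      ≤ ∑ ω, w ω * ⨆ ℓ : LossSeq K, regret π ℓ T :=
        Finset.sum_le_sum fun ω _ =>
          mul_le_mul_of_nonneg_left (le_ciSup (bddAbove_regret π T) (ℓ ω)) (hw ω)
    _ = ⨆ ℓ : LossSeq K, regret π ℓ T := by rw [← Finset.sum_mul, hw1, one_mul]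

/-! ### Upper bound: Exp3 with delay -/

section Exp3

variable {K d : ℕ} {η : ℝ} {y : ℕ → Fin K → ℝ}

/-- The distribution from which Exp3 draws the action of round `t`. -/
noncomputable def exp3Prob (d : ℕ) (η : ℝ) (y : ℕ → Fin K → ℝ) (t : ℕ) (i : Fin K) : ℝ :=
  exp3Weight d η y t i / ∑ j, exp3Weight d η y t j

/-- The importance-weighted estimate of the loss of action `i` in round `t`. -/
noncomputable def lossEst (d : ℕ) (η : ℝ) (y : ℕ → Fin K → ℝ) (t : ℕ) (i : Fin K) : ℝ :=
  y t i / exp3Prob d η y t i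

theorem exp3Weight_succ_of_lt {t : ℕ} (h : t < d) (i : Fin K) :
    exp3Weight d η y (t + 1) i = exp3Prob d η y t i := by
  rw [exp3Weight]
  beta_reduce
  rw [if_neg (by omega), mul_zero, Real.exp_zero, mul_one, exp3Prob]

theorem exp3Weight_add_succ (t : ℕ) (i : Fin K) :
    exp3Weight d η y (t + d + 1) i =
      exp3Prob d η y (t + d) i * Real.exp (-η * lossEst d η y t i) := by
  rw [exp3Weight]
  beta_reduce
  rw [if_pos (by omega), Nat.add_sub_cancel]
  rfl

theorem exp3Weight_congr {y' : ℕ → Fin K → ℝ} {t : ℕ} (h : ∀ s, s + d < t → y s = y' s) :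
    exp3Weight d η y t = exp3Weight d η y' t := by
  induction t using Nat.strong_induction_on with
  | _ t ih =>
    cases t with
    | zero => funext i; simp [exp3Weight]
    | succ t =>
      funext i
      rw [exp3Weight, exp3Weight, ih t (by omega) fun s hs => h s (by omega),
        ih (t - d) (by omega) fun s hs => h s (by omega)]
      by_cases hd : d ≤ t
      · rw [h (t - d) (by omega)]
      · simp only [if_neg hd]

theorem exp3Prob_congr {y' : ℕ → Fin K → ℝ} {t : ℕ} (h : ∀ s, s + d < t → y s = y' s) :
    exp3Prob d η y t = exp3Prob d η y' t := by
  unfold exp3Prob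
  rw [exp3Weight_congr h]

theorem sum_exp3Weight_pos (hK : 0 < K) (t : ℕ) : 0 < ∑ j, exp3Weight d η y t j :=
  Finset.sum_pos (fun j _ => exp3Weight_pos d η y t j) ⟨⟨0, hK⟩, Finset.mem_univ _⟩

theorem exp3Prob_pos (t : ℕ) (i : Fin K) : 0 < exp3Prob d η y t i :=
  div_pos (exp3Weight_pos d η y t i) (sum_exp3Weight_pos i.pos t)

theorem sum_exp3Prob (hK : 0 < K) (t : ℕ) : ∑ i, exp3Prob d η y t i = 1 := by
  unfold exp3Prob
  rw [← Finset.sum_div, div_self (sum_exp3Weight_pos hK t).ne']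

theorem exp3Prob_le_one (t : ℕ) (i : Fin K) : exp3Prob d η y t i ≤ 1 := by
  rw [← sum_exp3Prob (d := d) (η := η) (y := y) i.pos t]
  exact Finset.single_le_sum (fun j _ => (exp3Prob_pos t j).le) (Finset.mem_univ i)

theorem exp3Prob_succ_of_lt {t : ℕ} (h : t < d) (i : Fin K) :
    exp3Prob d η y (t + 1) i = exp3Prob d η y t i := by
  conv_lhs => rw [exp3Prob]
  simp only [exp3Weight_succ_of_lt h, sum_exp3Prob i.pos, div_one]

theorem exp3Prob_of_le {t : ℕ} (h : t ≤ d) (i : Fin K) : exp3Prob d η y t i = 1 / K := by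
  induction t with
  | zero => simp [exp3Prob, exp3Weight]
  | succ t ih => rw [exp3Prob_succ_of_lt h, ih (by omega)]

theorem lossEst_nonneg (hy : ∀ s i, 0 ≤ y s i) (t : ℕ) (i : Fin K) : 0 ≤ lossEst d η y t i :=
  div_nonneg (hy t i) (exp3Prob_pos t i).le

theorem exp3Prob_mul_lossEst (t : ℕ) (i : Fin K) :
    exp3Prob d η y t i * lossEst d η y t i = y t i :=
  mul_div_cancel₀ _ (exp3Prob_pos t i).ne'

theorem exp3Weight_add_succ_le (hη : 0 < η) (hy : ∀ s i, 0 ≤ y s i) (t : ℕ) (i : Fin K) :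
    exp3Weight d η y (t + d + 1) i ≤ exp3Prob d η y (t + d) i := by
  rw [exp3Weight_add_succ]
  refine mul_le_of_le_one_right (exp3Prob_pos _ i).le (Real.exp_le_one_iff.2 ?_)
  nlinarith [lossEst_nonneg (d := d) (η := η) hy t i]

theorem le_exp3Weight_add_succ (t : ℕ) (i : Fin K) :
    exp3Prob d η y (t + d) i - η * (exp3Prob d η y (t + d) i * lossEst d η y t i) ≤
      exp3Weight d η y (t + d + 1) i := by
  rw [exp3Weight_add_succ]
  nlinarith [exp3Prob_pos (d := d) (η := η) (y := y) (t + d) i,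
    Real.add_one_le_exp (-η * lossEst d η y t i)]

theorem sum_exp3Weight_add_succ_le_one (hη : 0 < η) (hy : ∀ s i, 0 ≤ y s i) (hK : 0 < K)
    (t : ℕ) : ∑ i, exp3Weight d η y (t + d + 1) i ≤ 1 := by
  rw [← sum_exp3Prob (d := d) (η := η) (y := y) hK (t + d)]
  exact Finset.sum_le_sum fun i _ => exp3Weight_add_succ_le hη hy t i

theorem exp3Weight_le_exp3Prob (hη : 0 < η) (hy : ∀ s i, 0 ≤ y s i) (t : ℕ) (i : Fin K) :
    exp3Weight d η y (t + d + 1) i ≤ exp3Prob d η y (t + d + 1) i := by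
  rw [exp3Prob, le_div_iff₀ (sum_exp3Weight_pos i.pos _)]
  exact mul_le_of_le_one_right (exp3Weight_pos d η y _ i).le
    (sum_exp3Weight_add_succ_le_one hη hy i.pos t)

/-- Doubling turns p_{s+d}·ℓ̂_s into at most 2 p_s·ℓ̂_s, and there the importance weights cancel. -/
theorem sum_exp3Prob_mul_lossEst_le {s : ℕ} (hy : ∀ s i, 0 ≤ y s i) (hy1 : ∀ s, ∑ i, y s i ≤ 1)
    (h : ∀ i, exp3Prob d η y (s + d) i ≤ 2 * exp3Prob d η y s i) :
    ∑ i, exp3Prob d η y (s + d) i * lossEst d η y s i ≤ 2 := by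
  calc ∑ i, exp3Prob d η y (s + d) i * lossEst d η y s i
      ≤ ∑ i, 2 * y s i := Finset.sum_le_sum fun i _ => by
        rw [← exp3Prob_mul_lossEst (d := d) (η := η) (y := y) s i, ← mul_assoc]
        exact mul_le_mul_of_nonneg_right (h i) (lossEst_nonneg hy s i)
    _ ≤ 2 := by rw [← Finset.mul_sum]; linarith [hy1 s]

/-- The one-step bound is a hypothesis restricted to rounds before s+d, so that this lemma can serve
inside the strong induction that proves that bound. -/
theorem exp3Prob_add_le_of_succ {s : ℕ} (hη : 0 < η) (hd : 4 * η * (d + 1) ≤ 1)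
    (h : ∀ r < s + d, ∀ i, exp3Prob d η y (r + 1) i * (1 - 2 * η) ≤ exp3Prob d η y r i)
    (i : Fin K) : exp3Prob d η y (s + d) i ≤ 2 * exp3Prob d η y s i := by
  have hd0 : (0 : ℝ) ≤ d := d.cast_nonneg
  have hη' : 0 ≤ 1 - 2 * η := by nlinarith [mul_nonneg hη.le hd0]
  have key : ∀ m ≤ d, exp3Prob d η y (s + m) i * (1 - 2 * η) ^ m ≤ exp3Prob d η y s i := by
    intro m
    induction m with
    | zero => simp
    | succ m ih =>
      intro hm
      refine le_trans ?_ (ih (by omega))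
      rw [pow_succ', ← mul_assoc]
      exact mul_le_mul_of_nonneg_right (h (s + m) (by omega) i) (pow_nonneg hη' _)
  -- Bernoulli's inequality gives 1 - 2ηd, which is at least 1/2 by `hd`.
  have hpow : 1 / 2 ≤ (1 - 2 * η) ^ d := by
    have := one_add_mul_le_pow (a := -(2 * η)) (by linarith) d
    rw [← sub_eq_add_neg (1 : ℝ) (2 * η)] at this
    nlinarith
  nlinarith [key d le_rfl, exp3Prob_pos (d := d) (η := η) (y := y) (s + d) i]

/-- Probabilities grow only through the normaliser. Earlier growth is controlled by induction, hence
p_{s+d}·ℓ̂_s ≤ 2 and the normaliser is at least 1 - 2η. -/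
theorem exp3Prob_succ_mul_le (hη : 0 < η) (hd : 4 * η * (d + 1) ≤ 1) (hy : ∀ s i, 0 ≤ y s i)
    (hy1 : ∀ s, ∑ i, y s i ≤ 1) (t : ℕ) (i : Fin K) :
    exp3Prob d η y (t + 1) i * (1 - 2 * η) ≤ exp3Prob d η y t i := by
  induction t using Nat.strong_induction_on generalizing i with
  | _ t ih =>
    rcases lt_or_ge t d with h | h
    · rw [exp3Prob_succ_of_lt h]
      nlinarith [exp3Prob_pos (d := d) (η := η) (y := y) t i]
    · obtain ⟨s, rfl⟩ := Nat.exists_eq_add_of_le' h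
      have h2 := sum_exp3Prob_mul_lossEst_le hy hy1 fun j =>
        exp3Prob_add_le_of_succ hη hd ih j
      have hW : 1 - 2 * η ≤ ∑ j, exp3Weight d η y (s + d + 1) j := by
        have := Finset.sum_le_sum fun j (_ : j ∈ Finset.univ) =>
          le_exp3Weight_add_succ (d := d) (η := η) (y := y) s j
        rw [Finset.sum_sub_distrib, sum_exp3Prob i.pos, ← Finset.mul_sum] at this
        nlinarith
      calc exp3Prob d η y (s + d + 1) i * (1 - 2 * η)
          ≤ exp3Prob d η y (s + d + 1) i * ∑ j, exp3Weight d η y (s + d + 1) j :=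
            mul_le_mul_of_nonneg_left hW (exp3Prob_pos _ i).le
        _ = exp3Weight d η y (s + d + 1) i :=
            div_mul_cancel₀ _ (sum_exp3Weight_pos i.pos _).ne'
        _ ≤ exp3Prob d η y (s + d) i := exp3Weight_add_succ_le hη hy s i

/-- With a small learning rate, `d` rounds at most double each probability. -/
theorem exp3Prob_add_le (hη : 0 < η) (hd : 4 * η * (d + 1) ≤ 1) (hy : ∀ s i, 0 ≤ y s i)
    (hy1 : ∀ s, ∑ i, y s i ≤ 1) (t : ℕ) (i : Fin K) :
    exp3Prob d η y (t + d) i ≤ 2 * exp3Prob d η y t i :=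
  exp3Prob_add_le_of_succ hη hd (fun r _ j => exp3Prob_succ_mul_le hη hd hy hy1 r j) i

/-- The normaliser is at most 1, so a probability drops by no more than its unnormalised weight
does, which is at most η p_{s+d}(i) ℓ̂_s(i). -/
theorem sum_exp3Prob_sub_succ_le (hη : 0 < η) (hd : 4 * η * (d + 1) ≤ 1)
    (hy : ∀ s i, 0 ≤ y s i) (hy1 : ∀ s, ∑ i, y s i ≤ 1) {l : Fin K → ℝ} (hl : ∀ i, 0 ≤ l i)
    (hl1 : ∀ i, l i ≤ 1) (t : ℕ) :
    ∑ i, (exp3Prob d η y t i - exp3Prob d η y (t + 1) i) * l i ≤ 2 * η := by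
  rcases lt_or_ge t d with h | h
  · simp only [exp3Prob_succ_of_lt h, sub_self, zero_mul, Finset.sum_const_zero]
    linarith
  · obtain ⟨s, rfl⟩ := Nat.exists_eq_add_of_le' h
    calc ∑ i, (exp3Prob d η y (s + d) i - exp3Prob d η y (s + d + 1) i) * l i
        ≤ ∑ i, η * (exp3Prob d η y (s + d) i * lossEst d η y s i) :=
          Finset.sum_le_sum fun i _ => by
            have h0 : 0 ≤ η * (exp3Prob d η y (s + d) i * lossEst d η y s i) :=
              mul_nonneg hη.le (mul_nonneg (exp3Prob_pos _ i).le (lossEst_nonneg hy s i))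
            have h1 := le_exp3Weight_add_succ (d := d) (η := η) (y := y) s i
            have h2 := exp3Weight_le_exp3Prob (d := d) hη hy s i
            calc _ ≤ η * (exp3Prob d η y (s + d) i * lossEst d η y s i) * l i :=
                  mul_le_mul_of_nonneg_right (by linarith) (hl i)
              _ ≤ _ := mul_le_of_le_one_right h0 (hl1 i)
      _ ≤ 2 * η := by
          rw [← Finset.mul_sum]
          nlinarith [sum_exp3Prob_mul_lossEst_le hy hy1 (exp3Prob_add_le hη hd hy hy1 s)]

/-- Over `m` rounds the expected loss of the distribution moves by at most `2 η m`. -/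
theorem sum_exp3Prob_mul_le (hη : 0 < η) (hd : 4 * η * (d + 1) ≤ 1)
    (hy : ∀ s i, 0 ≤ y s i) (hy1 : ∀ s, ∑ i, y s i ≤ 1) {l : Fin K → ℝ} (hl : ∀ i, 0 ≤ l i)
    (hl1 : ∀ i, l i ≤ 1) (t m : ℕ) :
    ∑ i, exp3Prob d η y t i * l i ≤ ∑ i, exp3Prob d η y (t + m) i * l i + 2 * η * m := by
  induction m with
  | zero => simp
  | succ m ih =>
    have := sum_exp3Prob_sub_succ_le hη hd hy hy1 hl hl1 (t + m)
    simp only [sub_mul, Finset.sum_sub_distrib] at this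
    push_cast
    rw [← add_assoc]
    linarith

/-- Follows from exp x ≥ 1 + x and (1 + x)(1 - x + x²) = 1 + x³ ≥ 1. No upper bound on x is needed,
which matters because the estimates are unbounded. -/
theorem exp_neg_le_of_nonneg {x : ℝ} (hx : 0 ≤ x) : Real.exp (-x) ≤ 1 - x + x ^ 2 := by
  rw [Real.exp_neg]
  refine inv_le_of_inv_le₀ (by nlinarith) ?_
  refine le_trans ?_ (Real.add_one_le_exp x)
  rw [inv_le_iff_one_le_mul₀ (by nlinarith)]
  nlinarith [pow_nonneg hx 3]

/-- One step of the potential log p(k): the comparator term is exact, and the logarithm of the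
normaliser is expanded to second order. -/
theorem log_exp3Prob_step (hη : 0 < η) (hd : 4 * η * (d + 1) ≤ 1) (hy : ∀ s i, 0 ≤ y s i)
    (hy1 : ∀ s, ∑ i, y s i ≤ 1) (t : ℕ) (k : Fin K) :
    η * (∑ i, exp3Prob d η y (t + d) i * lossEst d η y t i - lossEst d η y t k -
        2 * η * ∑ i, lossEst d η y t i) ≤
      Real.log (exp3Prob d η y (t + d + 1) k) - Real.log (exp3Prob d η y (t + d) k) := by
  have hW := sum_exp3Weight_pos (d := d) (η := η) (y := y) k.pos (t + d + 1)
  have hlog : Real.log (∑ j, exp3Weight d η y (t + d + 1) j) ≤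
      -η * (∑ i, exp3Prob d η y (t + d) i * lossEst d η y t i) +
        2 * η ^ 2 * ∑ i, lossEst d η y t i := by
    refine (Real.log_le_sub_one_of_pos hW).trans ?_
    have : ∑ j, exp3Weight d η y (t + d + 1) j ≤
        ∑ i, (exp3Prob d η y (t + d) i - η * (exp3Prob d η y (t + d) i * lossEst d η y t i) +
          2 * η ^ 2 * lossEst d η y t i) := by
      refine Finset.sum_le_sum fun i _ => ?_
      have hp := exp3Prob_pos (d := d) (η := η) (y := y) (t + d) i
      have hL := lossEst_nonneg (d := d) (η := η) hy t i
      have hyi : y t i ≤ 1 :=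
        (Finset.single_le_sum (fun j _ => hy t j) (Finset.mem_univ i)).trans (hy1 t)
      -- The estimate is weighted by p_t but averaged under p_{t+d}; doubling lets one factor ℓ̂
      -- cancel all the same.
      have hsq : exp3Prob d η y (t + d) i * lossEst d η y t i ^ 2 ≤ 2 * lossEst d η y t i := by
        calc exp3Prob d η y (t + d) i * lossEst d η y t i ^ 2
            ≤ 2 * exp3Prob d η y t i * lossEst d η y t i ^ 2 :=
              mul_le_mul_of_nonneg_right (exp3Prob_add_le hη hd hy hy1 t i) (sq_nonneg _)
          _ = 2 * (y t i * lossEst d η y t i) := by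
              rw [← exp3Prob_mul_lossEst (d := d) (η := η) (y := y) t i]; ring
          _ ≤ 2 * lossEst d η y t i := by nlinarith
      rw [exp3Weight_add_succ, neg_mul]
      have he := mul_le_mul_of_nonneg_left (exp_neg_le_of_nonneg (mul_nonneg hη.le hL)) hp.le
      nlinarith [mul_le_mul_of_nonneg_left hsq (sq_nonneg η)]
    rw [Finset.sum_add_distrib, Finset.sum_sub_distrib, sum_exp3Prob k.pos, ← Finset.mul_sum,
      ← Finset.mul_sum] at this
    linarith
  have hk : Real.log (exp3Prob d η y (t + d + 1) k) = Real.log (exp3Prob d η y (t + d) k) +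
      -η * lossEst d η y t k - Real.log (∑ j, exp3Weight d η y (t + d + 1) j) := by
    rw [exp3Prob, Real.log_div (exp3Weight_pos d η y _ k).ne' hW.ne', exp3Weight_add_succ,
      Real.log_mul (exp3Prob_pos _ k).ne' (Real.exp_pos _).ne', Real.log_exp]
  rw [hk]
  linarith

/-- The exponential-weights inequality along a fixed path. -/
theorem sum_exp3Prob_mul_lossEst_le_add (hη : 0 < η) (hd : 4 * η * (d + 1) ≤ 1)
    (hy : ∀ s i, 0 ≤ y s i) (hy1 : ∀ s, ∑ i, y s i ≤ 1) (T : ℕ) (k : Fin K) :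
    ∑ t : Fin T, ∑ i, exp3Prob d η y (t + d) i * lossEst d η y t i ≤
      ∑ t : Fin T, lossEst d η y t k + 2 * η * ∑ t : Fin T, ∑ i, lossEst d η y t i +
        Real.log K / η := by
  have h := Finset.sum_le_sum fun t (_ : t ∈ Finset.range T) =>
    log_exp3Prob_step hη hd hy hy1 t k
  -- The sum starts at round d, where the distribution is still uniform, and runs on to round T+d,
  -- when every loss of the first T rounds has been used.
  have htel : ∑ t ∈ Finset.range T, (Real.log (exp3Prob d η y (t + d + 1) k) -
      Real.log (exp3Prob d η y (t + d) k)) =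
      Real.log (exp3Prob d η y (T + d) k) - Real.log (exp3Prob d η y (0 + d) k) := by
    rw [← Finset.sum_range_sub fun t => Real.log (exp3Prob d η y (t + d) k)]
    refine Finset.sum_congr rfl fun t _ => ?_
    rw [add_right_comm]
  rw [htel, zero_add, exp3Prob_of_le le_rfl, one_div, Real.log_inv, ← Finset.mul_sum,
    Finset.sum_sub_distrib, Finset.sum_sub_distrib, ← Finset.mul_sum] at h
  have h0 := Real.log_nonpos (exp3Prob_pos (d := d) (η := η) (y := y) (T + d) k).le
    (exp3Prob_le_one _ k)
  simp only [Finset.sum_range] at h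
  have := (le_div_iff₀' hη).2 (h.trans (b := _) (c := Real.log K) (by linarith))
  linarith

variable {ℓ : LossSeq K}

/-- The losses suffered along the path `a`, listed by round and action. -/
noncomputable def playedLoss (ℓ : LossSeq K) {T : ℕ} (a : Fin T → Fin K) (s : ℕ) (i : Fin K) : ℝ :=
  if h : s < T then (if a ⟨s, h⟩ = i then (ℓ s i : ℝ) else 0) else 0

theorem playedLoss_nonneg {T : ℕ} (a : Fin T → Fin K) (s : ℕ) (i : Fin K) :
    0 ≤ playedLoss ℓ a s i := by
  unfold playedLoss
  split_ifs
  exacts [(ℓ s i).2.1, le_rfl, le_rfl]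

theorem sum_playedLoss_le_one {T : ℕ} (a : Fin T → Fin K) (s : ℕ) :
    ∑ i, playedLoss ℓ a s i ≤ 1 := by
  unfold playedLoss
  by_cases h : s < T
  · simpa [h] using (ℓ s (a ⟨s, h⟩)).2.2
  · simp [h]

theorem playedLoss_past {T : ℕ} (a : Fin T → Fin K) (t : Fin T) {s : ℕ} (h : s < t) :
    playedLoss ℓ (past a t) s = playedLoss ℓ a s := by
  funext i
  rw [playedLoss, playedLoss, dif_pos h, dif_pos (h.trans t.isLt)]
  rfl

theorem playedLoss_apply {T : ℕ} (a : Fin T → Fin K) (t : Fin T) (i : Fin K) :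
    playedLoss ℓ a t i = if a t = i then (ℓ t i : ℝ) else 0 := by
  simp [playedLoss]

theorem actionKernel_exp3 (hK : 0 < K) (n : ℕ) (h : Fin n → Fin K) (j : Fin K) :
    actionKernel (exp3 hK d η) ℓ n h j = exp3Prob d η (playedLoss ℓ h) n j := by
  unfold actionKernel exp3
  change exp3Prob d η _ n j = _
  refine congrFun (exp3Prob_congr fun s hs => ?_) j
  have h1 : s < n - d := by omega
  have h2 : s < n := by omega
  funext i
  simp only [playedLoss, h1, h2, dif_pos]
  split_ifs with hi
  · rw [hi]
  · rfl

/-- The distribution of round r uses only rounds s with s + d < r, and r ≤ t + d forces s < t. -/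
theorem exp3Prob_playedLoss_past {T : ℕ} (a : Fin T → Fin K) (t : Fin T) {r : ℕ}
    (hr : r ≤ t + d) :
    exp3Prob d η (playedLoss ℓ (past a t)) r = exp3Prob d η (playedLoss ℓ a) r :=
  exp3Prob_congr fun _ _ => playedLoss_past a t (by omega)

/-- Unbiasedness given the past of round t. The factor `F` will be p_{t+d}(i), which the past
determines. -/
theorem seqExp_mul_lossEst (hK : 0 < K) {T : ℕ} (t : Fin T) (i : Fin K)
    (F : (n : ℕ) → (Fin n → Fin K) → ℝ) :
    seqExp (actionKernel (exp3 hK d η) ℓ) T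
        (fun a => F t (past a t) * lossEst d η (playedLoss ℓ a) t i) =
      seqExp (actionKernel (exp3 hK d η) ℓ) T fun a => F t (past a t) * ℓ t i := by
  have h := seqExp_condExp (sum_actionKernel (exp3 hK d η) ℓ) t fun n h x =>
    F n h * ((if x = i then (ℓ n i : ℝ) else 0) / exp3Prob d η (playedLoss ℓ h) n i)
  have hl : ∀ a : Fin T → Fin K, F t (past a t) * ((if a t = i then (ℓ t i : ℝ) else 0) /
      exp3Prob d η (playedLoss ℓ (past a t)) t i) =
      F t (past a t) * lossEst d η (playedLoss ℓ a) t i := fun a => by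
    rw [lossEst, playedLoss_apply, exp3Prob_playedLoss_past a t (by omega)]
  simp only [hl] at h
  rw [h]
  congr 1
  funext a
  rw [Finset.sum_eq_single i]
  · rw [if_pos rfl, actionKernel_exp3]
    have := (exp3Prob_pos (d := d) (η := η) (y := playedLoss ℓ (past a t)) t i).ne'
    field_simp
  · intro j _ hj
    simp [hj]
  · simp

theorem seqExp_lossEst (hK : 0 < K) {T : ℕ} (t : Fin T) (i : Fin K) :
    seqExp (actionKernel (exp3 hK d η) ℓ) T
        (fun a => lossEst d η (playedLoss ℓ a) t i) = ℓ t i := by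
  have h := seqExp_mul_lossEst (d := d) (η := η) (ℓ := ℓ) hK t i fun _ _ => 1
  simp only [one_mul] at h
  rw [h, seqExp_const (sum_actionKernel _ ℓ)]

theorem regret_exp3_le (hK : 0 < K) (hη : 0 < η) (hd : 4 * η * (d + 1) ≤ 1) (ℓ : LossSeq K)
    (T : ℕ) :
    regret (exp3 hK d η) ℓ T ≤ Real.log K / η + 2 * η * ((K + d) * T) := by
  have : Nonempty (Fin K) := ⟨⟨0, hK⟩⟩
  suffices h : ∀ k : Fin K, expectedLoss (exp3 hK d η) ℓ T -
      (Real.log K / η + 2 * η * ((K + d) * T)) ≤ ∑ t ∈ Finset.range T, (ℓ t k : ℝ) by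
    have := le_ciInf h
    unfold regret
    linarith
  intro k
  set q := actionKernel (exp3 hK d η) ℓ with hqdef
  have hq : ∀ n h, ∑ x, q n h x = 1 := sum_actionKernel _ ℓ
  have hq0 : ∀ n h x, 0 ≤ q n h x := actionKernel_nonneg _ ℓ
  have h1 : expectedLoss (exp3 hK d η) ℓ T = seqExp q T fun a =>
      ∑ t : Fin T, ∑ i, exp3Prob d η (playedLoss ℓ a) t i * ℓ t i := by
    rw [expectedLoss_eq_seqExp, seqExp_sum, seqExp_sum]
    refine Finset.sum_congr rfl fun t _ => ?_
    rw [seqExp_condExp hq t fun n _ x => (ℓ n x : ℝ)]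
    congr 1
    funext a
    refine Finset.sum_congr rfl fun i _ => ?_
    rw [hqdef, actionKernel_exp3, exp3Prob_playedLoss_past a t (by omega)]
  have h2 : seqExp q T (fun a => ∑ t : Fin T, ∑ i, exp3Prob d η (playedLoss ℓ a) t i * ℓ t i) ≤
      seqExp q T fun a =>
        (∑ t : Fin T, ∑ i, exp3Prob d η (playedLoss ℓ a) (t + d) i * ℓ t i) + T * (2 * η * d) := by
    refine seqExp_mono hq0 fun a => ?_
    refine (Finset.sum_le_sum fun (t : Fin T) _ => sum_exp3Prob_mul_le hη hd
      (playedLoss_nonneg (ℓ := ℓ) a) (sum_playedLoss_le_one a) (fun i => (ℓ t i).2.1) (fun i => (ℓ t i).2.2) t d).trans_eq ?_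
    rw [Finset.sum_add_distrib]
    simp
  have h3 : seqExp q T (fun a =>
      ∑ t : Fin T, ∑ i, exp3Prob d η (playedLoss ℓ a) (t + d) i * ℓ t i) =
      seqExp q T fun a => ∑ t : Fin T, ∑ i,
        exp3Prob d η (playedLoss ℓ a) (t + d) i * lossEst d η (playedLoss ℓ a) t i := by
    simp only [seqExp_sum]
    refine Finset.sum_congr rfl fun t _ => Finset.sum_congr rfl fun i _ => ?_
    have := seqExp_mul_lossEst (d := d) (η := η) (ℓ := ℓ) hK t i fun n h =>
      exp3Prob d η (playedLoss ℓ h) (n + d) i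
    simp only [exp3Prob_playedLoss_past _ t le_rfl] at this
    exact this.symm
  have h4 : seqExp q T (fun a => ∑ t : Fin T, ∑ i,
        exp3Prob d η (playedLoss ℓ a) (t + d) i * lossEst d η (playedLoss ℓ a) t i) ≤
      ∑ t : Fin T, (ℓ t k : ℝ) + 2 * η * ∑ t : Fin T, ∑ i, (ℓ t i : ℝ) + Real.log K / η := by
    refine (seqExp_mono hq0 fun a => sum_exp3Prob_mul_lossEst_le_add hη hd
      (playedLoss_nonneg a) (sum_playedLoss_le_one a) T k).trans_eq ?_
    simp only [seqExp_add, seqExp_const_mul, seqExp_sum, hqdef, seqExp_lossEst,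
      seqExp_const (sum_actionKernel _ ℓ)]
  have h5 : ∑ t : Fin T, ∑ i, (ℓ t i : ℝ) ≤ T * K := by
    calc ∑ t : Fin T, ∑ i, (ℓ t i : ℝ) ≤ ∑ _t : Fin T, ∑ _i : Fin K, (1 : ℝ) :=
          Finset.sum_le_sum fun t _ => Finset.sum_le_sum fun i _ => (ℓ t i).2.2
      _ = T * K := by simp
  rw [seqExp_add, seqExp_const hq, h3] at h2
  rw [Finset.sum_range, h1]
  nlinarith

/-- The regret of Exp3 with a learning rate tuned to `K`, `d` and `T`. -/
theorem exists_regret_exp3_le (hK : 2 ≤ K) (d T : ℕ) :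
    ∃ η : ℝ, 0 < η ∧ ∀ ℓ : LossSeq K, regret (exp3 (Nat.zero_lt_of_lt hK) d η) ℓ T ≤
      5 * √(((K : ℝ) + d) * T * Real.log K) := by
  have hK' : (2 : ℝ) ≤ K := by exact_mod_cast hK
  have hd0 : (0 : ℝ) ≤ d := d.cast_nonneg
  have hlog : 0 < Real.log K := Real.log_pos (by linarith)
  rcases le_or_gt (T : ℝ) ((K + d) * Real.log K) with h | h
  -- On a short horizon the trivial bound T is already below the square root, so any learning rate
  -- will do.
  · refine ⟨1, one_pos, fun ℓ => (regret_le_length _ ℓ T).trans ?_⟩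
    have : (T : ℝ) ≤ √(((K : ℝ) + d) * T * Real.log K) := by
      apply Real.le_sqrt_of_sq_le
      nlinarith [T.cast_nonneg (α := ℝ)]
    linarith [Real.sqrt_nonneg (((K : ℝ) + d) * T * Real.log K)]
  · have hKd : (0 : ℝ) < K + d := by linarith
    have hT : (0 : ℝ) < T := (mul_pos hKd hlog).trans h
    set S := √(((K : ℝ) + d) * T * Real.log K) with hS
    have hS2 : S ^ 2 = (K + d) * T * Real.log K := Real.sq_sqrt (by positivity)
    have hS0 : 0 < S := Real.sqrt_pos.2 (by positivity)
    have hSlow : (K + d) * Real.log K ≤ S := by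
      apply Real.le_sqrt_of_sq_le
      nlinarith [mul_pos hKd hlog]
    -- The bound becomes 4S + S/2, and (K+d) log K ≤ S is what makes this rate satisfy 4η(d+1) ≤ 1.
    refine ⟨Real.log K / (4 * S), by positivity, fun ℓ =>
      (regret_exp3_le _ (by positivity) ?_ ℓ T).trans ?_⟩
    · rw [show 4 * (Real.log K / (4 * S)) * ((d : ℝ) + 1) = ((d + 1) * Real.log K) / S by
        field_simp, div_le_one hS0]
      nlinarith
    · have h1 : Real.log K / (Real.log K / (4 * S)) = 4 * S := by field_simp
      have h2 : 2 * (Real.log K / (4 * S)) * ((K + d) * T) = S / 2 := by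
        field_simp
        nlinarith
      rw [h1, h2]
      linarith

end Exp3

/-! ### Lower bound from bandit feedback -/

section BanditLowerBound

/-- A product measure on arrays, seen along one entry of each row. -/
theorem sum_prod_prod_mul_apply {ι κ β : Type*} [Fintype ι] [Fintype κ] [Fintype β]
    [DecidableEq ι] [DecidableEq κ] [DecidableEq β] {p : κ → β → ℝ} (hp : ∀ j, ∑ x, p j x = 1)
    (a : ι → κ) (F : (ι → β) → ℝ) :
    ∑ ω : ι → κ → β, (∏ t, ∏ j, p j (ω t j)) * F (fun t => ω t (a t)) =
      ∑ x : ι → β, (∏ t, p (a t) (x t)) * F x := by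
  -- The indicator is a product over all entries, so the sum factorises and each entry that is not
  -- read contributes 1.
  have key : ∀ x : ι → β, ∑ ω : ι → κ → β, (∏ t, ∏ j, p j (ω t j)) *
      (if (fun t => ω t (a t)) = x then 1 else 0) = ∏ t, p (a t) (x t) := by
    intro x
    calc ∑ ω : ι → κ → β, (∏ t, ∏ j, p j (ω t j)) * (if (fun t => ω t (a t)) = x then 1 else 0)
        = ∑ ω : ι → κ → β, ∏ t, ∏ j,
            p j (ω t j) * (if j = a t then (if ω t j = x t then 1 else 0) else 1) := by
          refine Finset.sum_congr rfl fun ω _ => ?_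
          simp only [Finset.prod_mul_distrib, Finset.prod_ite_eq', Finset.mem_univ, if_true]
          congr 1
          simp only [Finset.prod_ite_zero, Finset.prod_const_one, funext_iff, Finset.mem_univ,
            true_implies]
      _ = ∏ t, ∏ j, ∑ b, p j b * (if j = a t then (if b = x t then 1 else 0) else 1) := by
          simp only [Finset.prod_univ_sum, Fintype.piFinset_univ]
      _ = ∏ t, p (a t) (x t) := by
          refine Finset.prod_congr rfl fun t _ => ?_
          rw [Finset.prod_eq_single (a t)]
          · simp
          · intro j _ hj
            simp [hj, hp]
          · simp
  calc ∑ ω : ι → κ → β, (∏ t, ∏ j, p j (ω t j)) * F (fun t => ω t (a t))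
      = ∑ ω : ι → κ → β, ∑ x, (∏ t, ∏ j, p j (ω t j)) *
          (if (fun t => ω t (a t)) = x then 1 else 0) * F x := by
        refine Finset.sum_congr rfl fun ω _ => ?_
        simp
    _ = ∑ x : ι → β, (∏ t, p (a t) (x t)) * F x := by
        rw [Finset.sum_comm]
        simp only [← Finset.sum_mul, key]

/-- A form of Pinsker's inequality: total variation against relative entropy, for the laws `P`
and `P * r`. -/
theorem sum_mul_abs_sub_one_sq_le {ι : Type*} [Fintype ι] {P r : ι → ℝ} (hP : ∀ i, 0 ≤ P i)
    (hr : ∀ i, 0 < r i) (hP1 : ∑ i, P i = 1) (hr1 : ∑ i, P i * r i = 1) :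
    (∑ i, P i * |r i - 1|) ^ 2 ≤ 4 * ∑ i, P i * -Real.log (r i) := by
  -- Cauchy–Schwarz for |r - 1| = |√r - 1|(√r + 1); the first factor is a squared Hellinger
  -- distance.
  have hcs : (∑ i, P i * |r i - 1|) ^ 2 ≤
      (∑ i, P i * (√(r i) - 1) ^ 2) * ∑ i, P i * (√(r i) + 1) ^ 2 := by
    refine Finset.sum_sq_le_sum_mul_sum_of_sq_le_mul _
      (fun i _ => mul_nonneg (hP i) (sq_nonneg _)) (fun i _ => mul_nonneg (hP i) (sq_nonneg _))
      fun i _ => le_of_eq ?_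
    have hs := Real.sq_sqrt (hr i).le
    rw [mul_pow, sq_abs, show r i - 1 = (√(r i) - 1) * (√(r i) + 1) by nlinarith]
    ring
  have h1 : ∑ i, P i * (√(r i) - 1) ^ 2 ≤ ∑ i, P i * -Real.log (r i) := by
    have hlin : ∑ i, P i * (√(r i) - 1) ^ 2 = ∑ i, P i * (2 * (1 - √(r i))) := by
      have : ∀ i, P i * (√(r i) - 1) ^ 2 = P i * (2 * (1 - √(r i))) + (P i * r i - P i) :=
        fun i => by
          have hs := Real.sq_sqrt (hr i).le
          linear_combination P i * hs
      simp only [this, Finset.sum_add_distrib, Finset.sum_sub_distrib, hP1, hr1]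
      ring
    rw [hlin]
    refine Finset.sum_le_sum fun i _ => mul_le_mul_of_nonneg_left ?_ (hP i)
    have := Real.log_le_sub_one_of_pos (Real.sqrt_pos.2 (hr i))
    rw [Real.log_sqrt (hr i).le] at this
    linarith
  have h2 : ∑ i, P i * (√(r i) + 1) ^ 2 ≤ 4 := by
    calc ∑ i, P i * (√(r i) + 1) ^ 2 ≤ ∑ i, (2 * (P i * r i) + 2 * P i) := by
          refine Finset.sum_le_sum fun i _ => ?_
          have hs : P i * √(r i) ^ 2 = P i * r i := by rw [Real.sq_sqrt (hr i).le]
          linarith [mul_nonneg (hP i) (sq_nonneg (√(r i) - 1))]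
      _ = 4 := by
          rw [Finset.sum_add_distrib, ← Finset.mul_sum, ← Finset.mul_sum, hP1, hr1]
          norm_num
  have h0 : 0 ≤ ∑ i, P i * (√(r i) - 1) ^ 2 :=
    Finset.sum_nonneg fun i _ => mul_nonneg (hP i) (sq_nonneg _)
  nlinarith

variable {K d : ℕ}

/-- The loss encoded by a bit. -/
noncomputable def bitLoss (x : Bool) : Set.Icc (0 : ℝ) 1 := if x then 1 else 0

/-- The law of a bit that is `true` with probability `1 / 2 - b j`. -/
noncomputable def coinProb (b : Fin K → ℝ) (j : Fin K) (x : Bool) : ℝ :=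
  if x then 1 / 2 - b j else 1 / 2 + b j

theorem sum_coinProb (b : Fin K → ℝ) (j : Fin K) : ∑ x, coinProb b j x = 1 := by
  simp [coinProb]
  norm_num

theorem coinProb_single_nonneg {i : Fin K} {ε : ℝ} (hε : ε ≤ 1 / 2) (hε0 : 0 ≤ ε) (j : Fin K)
    (x : Bool) : 0 ≤ coinProb (Pi.single i ε) j x := by
  unfold coinProb
  rw [Pi.single_apply]
  split_ifs <;> linarith

theorem sum_coinProb_mul_bitLoss (b : Fin K → ℝ) (j : Fin K) :
    ∑ x, coinProb b j x * (bitLoss x : ℝ) = 1 / 2 - b j := by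
  simp [coinProb, bitLoss]

/-- The loss sequence encoded by an array of bits. -/
noncomputable def arrayLoss {T : ℕ} (ω : Fin T → Fin K → Bool) : LossSeq K := fun t j =>
  if h : t < T then bitLoss (ω ⟨t, h⟩ j) else 0

theorem arrayLoss_apply {T : ℕ} (ω : Fin T → Fin K → Bool) (t : Fin T) (j : Fin K) :
    arrayLoss ω t j = bitLoss (ω t j) := by
  simp [arrayLoss]

/-- The law of the action and the suffered loss of round `n` given the earlier ones, when the
losses of action `j` are independent bits with law `coinProb b j`. -/
noncomputable def playKernel (π : Strategy K d) (b : Fin K → ℝ) (n : ℕ)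
    (h : Fin n → Fin K × Bool) (z : Fin K × Bool) : ℝ :=
  (π n (fun s => (h s).1) (fun s => bitLoss (h ⟨s, s.isLt.trans_le (Nat.sub_le _ _)⟩).2) :
    Fin K → ℝ) z.1 * coinProb b z.1 z.2

theorem sum_playKernel_mul (π : Strategy K d) (b : Fin K → ℝ) (n : ℕ) (h : Fin n → Fin K × Bool)
    (g : Fin K × Bool → ℝ) :
    ∑ z, playKernel π b n h z * g z =
      ∑ z, playKernel π b n h z * ∑ x, coinProb b z.1 x * g (z.1, x) := by
  simp only [Fintype.sum_prod_type, playKernel]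
  refine Finset.sum_congr rfl fun j _ => ?_
  rw [← Finset.sum_mul, ← Finset.mul_sum, sum_coinProb, mul_one, Finset.mul_sum]
  exact Finset.sum_congr rfl fun x _ => mul_assoc _ _ _

theorem sum_playKernel (π : Strategy K d) (b : Fin K → ℝ) (n : ℕ) (h : Fin n → Fin K × Bool) :
    ∑ z, playKernel π b n h z = 1 := by
  simp only [Fintype.sum_prod_type, playKernel, ← Finset.mul_sum, sum_coinProb, mul_one]
  exact (π n _ _).2.2

theorem playKernel_nonneg (π : Strategy K d) {b : Fin K → ℝ} (hb : ∀ j x, 0 ≤ coinProb b j x)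
    (n : ℕ) (h : Fin n → Fin K × Bool) (z : Fin K × Bool) : 0 ≤ playKernel π b n h z :=
  mul_nonneg ((π n _ _).2.1 _) (hb _ _)

theorem seqExp_playKernel (π : Strategy K d) (b : Fin K → ℝ) {T : ℕ} (t : Fin T)
    (g : Fin K × Bool → ℝ) :
    seqExp (playKernel π b) T (fun z => g (z t)) =
      seqExp (playKernel π b) T fun z => ∑ x, coinProb b (z t).1 x * g ((z t).1, x) := by
  rw [seqExp_past_apply (sum_playKernel π b) t fun _ _ z => g z,
    seqExp_past_apply (sum_playKernel π b) t fun _ _ z => ∑ x, coinProb b z.1 x * g (z.1, x)]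
  simp only [← sum_playKernel_mul]

/-- Integrating out the losses that are not suffered. -/
theorem sum_expectation_arrayLoss (π : Strategy K d) (b : Fin K → ℝ) (T : ℕ)
    (G : (Fin T → Fin K × Bool) → ℝ) :
    ∑ ω : Fin T → Fin K → Bool, (∏ t, ∏ j, coinProb b j (ω t j)) *
        seqExp (actionKernel π (arrayLoss ω)) T (fun a => G fun t => (a t, ω t (a t))) =
      seqExp (playKernel π b) T G := by
  have hlaw : ∀ (ω : Fin T → Fin K → Bool) (a : Fin T → Fin K),
      seqLaw (actionKernel π (arrayLoss ω)) a = ∏ t : Fin T,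
        (π t (past a t) (fun s => bitLoss (ω ⟨s, (s.isLt.trans_le (Nat.sub_le _ _)).trans t.isLt⟩
          (a ⟨s, (s.isLt.trans_le (Nat.sub_le _ _)).trans t.isLt⟩))) : Fin K → ℝ) (a t) := by
    intro ω a
    refine Finset.prod_congr rfl fun t _ => ?_
    unfold actionKernel
    congr 4
    funext s
    exact congrArg _
      (arrayLoss_apply ω ⟨s, (s.isLt.trans_le (Nat.sub_le _ _)).trans t.isLt⟩ _)
  simp only [seqExp, Finset.mul_sum, hlaw]
  rw [Finset.sum_comm, ← (Equiv.arrowProdEquivProdArrow (Fin T) (fun _ => Fin K)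
    (fun _ => Bool)).symm.sum_comp, Fintype.sum_prod_type]
  refine Finset.sum_congr rfl fun a _ => ?_
  refine (sum_prod_prod_mul_apply (sum_coinProb b) a fun x => (∏ t : Fin T,
    (π t (past a t) (fun s => bitLoss
      (x ⟨s, (s.isLt.trans_le (Nat.sub_le _ _)).trans t.isLt⟩)) : Fin K → ℝ) (a t)) *
      G fun t => (a t, x t)).trans ?_
  refine Finset.sum_congr rfl fun x _ => ?_
  rw [← mul_assoc, ← Finset.prod_mul_distrib]
  congr 1
  exact Finset.prod_congr rfl fun t _ => mul_comm _ _

theorem sum_arrayLaw_mul (b : Fin K → ℝ) (T : ℕ) (i : Fin K) (F : (Fin T → Bool) → ℝ) :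
    ∑ ω : Fin T → Fin K → Bool, (∏ t, ∏ j, coinProb b j (ω t j)) * F (fun t => ω t i) =
      seqExp (fun _ _ x => coinProb b i x) T F :=
  sum_prod_prod_mul_apply (sum_coinProb b) (fun _ => i) F

theorem sum_arrayLaw (b : Fin K → ℝ) (T : ℕ) (i : Fin K) :
    ∑ ω : Fin T → Fin K → Bool, ∏ t, ∏ j, coinProb b j (ω t j) = 1 := by
  simpa [seqExp_const (q := fun _ _ x => coinProb b i x) fun _ _ => sum_coinProb b i] using
    sum_arrayLaw_mul b T i fun _ => 1

/-- The number of rounds in which action `i` is played. -/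
noncomputable def playCount {T : ℕ} (i : Fin K) (z : Fin T → Fin K × Bool) : ℝ :=
  ∑ t, if (z t).1 = i then 1 else 0

theorem playCount_nonneg {T : ℕ} (i : Fin K) (z : Fin T → Fin K × Bool) : 0 ≤ playCount i z :=
  Finset.sum_nonneg fun t _ => by split_ifs <;> norm_num

theorem playCount_le {T : ℕ} (i : Fin K) (z : Fin T → Fin K × Bool) : playCount i z ≤ T := by
  calc playCount i z ≤ ∑ _t : Fin T, (1 : ℝ) :=
        Finset.sum_le_sum fun t _ => by split_ifs <;> norm_num
    _ = T := by simp

theorem sum_playCount {T : ℕ} (z : Fin T → Fin K × Bool) : ∑ i, playCount i z = T := by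
  unfold playCount
  rw [Finset.sum_comm]
  simp

/-- A play of action i costs 1/2 - ε on average and any other play 1/2. The best action is replaced
by i, which can only lower the regret. -/
theorem average_regret_arrayLoss (π : Strategy K d) {ε : ℝ} (hε : ε ≤ 1 / 2) (hε0 : 0 ≤ ε)
    (T : ℕ) (i : Fin K) :
    ε * (T - seqExp (playKernel π (Pi.single i ε)) T (playCount i)) ≤
      ∑ ω : Fin T → Fin K → Bool, (∏ t, ∏ j, coinProb (Pi.single i ε) j (ω t j)) *
        regret π (arrayLoss ω) T := by
  set b : Fin K → ℝ := Pi.single i ε with hb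
  have hbi : b i = ε := by simp [hb]
  have hplay : ∑ ω : Fin T → Fin K → Bool, (∏ t, ∏ j, coinProb b j (ω t j)) *
      expectedLoss π (arrayLoss ω) T = T / 2 - ε * seqExp (playKernel π b) T (playCount i) := by
    have h := sum_expectation_arrayLoss π b T fun z => ∑ t, (bitLoss (z t).2 : ℝ)
    simp only [expectedLoss_eq_seqExp, arrayLoss_apply]
    rw [h, seqExp_sum]
    simp only [seqExp_playKernel π b _ fun z => (bitLoss z.2 : ℝ), sum_coinProb_mul_bitLoss]
    rw [← seqExp_sum, ← seqExp_const_mul, ← seqExp_const (sum_playKernel π b) T ((T : ℝ) / 2),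
      ← seqExp_sub]
    congr 1
    funext z
    rw [playCount, Finset.mul_sum, Finset.sum_sub_distrib]
    congr 1
    · simp [div_eq_mul_inv]
    · refine Finset.sum_congr rfl fun t _ => ?_
      simp [hb, Pi.single_apply]
  have harm : ∑ ω : Fin T → Fin K → Bool, (∏ t, ∏ j, coinProb b j (ω t j)) *
      ∑ t : Fin T, (arrayLoss ω t i : ℝ) = T / 2 - ε * T := by
    simp only [arrayLoss_apply]
    refine (sum_arrayLaw_mul b T i fun x => ∑ t, (bitLoss (x t) : ℝ)).trans ?_
    rw [seqExp_sum]
    have : ∀ t : Fin T, seqExp (fun _ _ x => coinProb b i x) T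
        (fun x => (bitLoss (x t) : ℝ)) = 1 / 2 - ε := fun t => by
      rw [seqExp_past_apply (fun _ _ => sum_coinProb b i) t fun _ _ x => (bitLoss x : ℝ)]
      simp only [sum_coinProb_mul_bitLoss]
      rw [seqExp_const (fun _ _ => sum_coinProb b i), hbi]
    simp only [this, Finset.sum_const, Finset.card_univ, Fintype.card_fin, nsmul_eq_mul]
    ring
  have hw : ∀ ω : Fin T → Fin K → Bool, 0 ≤ ∏ t, ∏ j, coinProb b j (ω t j) := fun ω =>
    Finset.prod_nonneg fun t _ => Finset.prod_nonneg fun j _ => coinProb_single_nonneg hε hε0 _ _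
  calc ε * (T - seqExp (playKernel π b) T (playCount i))
      = ∑ ω : Fin T → Fin K → Bool, (∏ t, ∏ j, coinProb b j (ω t j)) *
          (expectedLoss π (arrayLoss ω) T - ∑ t : Fin T, (arrayLoss ω t i : ℝ)) := by
        simp only [mul_sub, Finset.sum_sub_distrib, hplay, harm]
        ring
    _ ≤ _ := by
        refine Finset.sum_le_sum fun ω _ => mul_le_mul_of_nonneg_left ?_ (hw ω)
        have := iInf_sum_loss_le (arrayLoss ω) T i
        rw [Finset.sum_range] at this
        unfold regret
        linarith

/-- The likelihood ratio of one observation between biased and fair losses. -/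
noncomputable def coinRatio (i : Fin K) (ε : ℝ) (z : Fin K × Bool) : ℝ :=
  2 * coinProb (Pi.single i ε) z.1 z.2

theorem seqLaw_playKernel_single (π : Strategy K d) (i : Fin K) (ε : ℝ) {T : ℕ}
    (z : Fin T → Fin K × Bool) :
    seqLaw (playKernel π (Pi.single i ε)) z =
      seqLaw (playKernel π 0) z * ∏ t, coinRatio i ε (z t) := by
  unfold seqLaw
  rw [← Finset.prod_mul_distrib]
  refine Finset.prod_congr rfl fun t _ => ?_
  simp only [playKernel, coinRatio]
  rw [show coinProb (0 : Fin K → ℝ) (z t).1 (z t).2 = 1 / 2 by simp [coinProb]]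
  ring

/-- Relative entropy of one observation: -½ log(1 - 4ε²) if action i is played, and 0 otherwise. -/
theorem neg_log_coinRatio_le {ε : ℝ} (hε0 : 0 ≤ ε) (hε : ε ≤ 1 / 8) (i j : Fin K) :
    ∑ x, coinProb (0 : Fin K → ℝ) j x * -Real.log (coinRatio i ε (j, x)) ≤
      3 * ε ^ 2 * if j = i then 1 else 0 := by
  by_cases h : j = i
  · subst h
    have h1 : 2 * (1 / 2 - ε) ≠ 0 := by linarith
    have h2 : 2 * (1 / 2 + ε) ≠ 0 := by linarith
    have hpos : 0 < 2 * (1 / 2 - ε) * (2 * (1 / 2 + ε)) := by nlinarith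
    have hlog := Real.one_sub_inv_le_log_of_pos hpos
    rw [Real.log_mul h1 h2] at hlog
    have hinv : (2 * (1 / 2 - ε) * (2 * (1 / 2 + ε)))⁻¹ ≤ 1 + 6 * ε ^ 2 := by
      rw [inv_le_iff_one_le_mul₀ hpos]
      have : ε ^ 2 ≤ 1 / 64 := by nlinarith
      nlinarith [sq_nonneg ε, mul_nonneg (sq_nonneg ε) (sub_nonneg.2 this)]
    simp [coinProb, coinRatio, -one_div, -mul_inv_rev] at *
    linarith
  · simp [coinProb, coinRatio, h]

/-- Only plays of i carry information, so the relative entropy of the paths is at most 3ε² times the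
mean count under fair bits. Pinsker's inequality then gives an L¹ distance of at most 1/2. -/
theorem seqExp_playCount_single_le (π : Strategy K d) {ε : ℝ} (hε0 : 0 ≤ ε) (hε : ε ≤ 1 / 8)
    {T : ℕ} (i : Fin K) (hM : 48 * ε ^ 2 * seqExp (playKernel π 0) T (playCount i) ≤ 1) :
    seqExp (playKernel π (Pi.single i ε)) T (playCount i) ≤
      seqExp (playKernel π 0) T (playCount i) + T / 4 := by
  have hq0 : ∀ n h z, 0 ≤ playKernel π 0 n h z := playKernel_nonneg π fun j x => by
    unfold coinProb; split_ifs <;> norm_num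
  have hrpos : ∀ z : Fin K × Bool, 0 < coinRatio i ε z := fun z => by
    unfold coinRatio coinProb
    by_cases h : z.1 = i <;> cases z.2 <;> simp [h] <;> linarith
  set P : (Fin T → Fin K × Bool) → ℝ := seqLaw (playKernel π 0)
  set r : (Fin T → Fin K × Bool) → ℝ := fun z => ∏ t, coinRatio i ε (z t)
  have hP : ∀ z, 0 ≤ P z := seqLaw_nonneg hq0
  have hD := sum_mul_abs_sub_one_sq_le hP (r := r)
    (fun z => Finset.prod_pos fun t _ => hrpos _) (sum_seqLaw (sum_playKernel π 0) T) (by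
      simp only [P, r, ← seqLaw_playKernel_single]
      exact sum_seqLaw (sum_playKernel π _) T)
  have hKL : ∑ z, P z * -Real.log (r z) ≤
      3 * ε ^ 2 * seqExp (playKernel π 0) T (playCount i) := by
    have hlog : ∀ z, -Real.log (r z) = ∑ t, -Real.log (coinRatio i ε (z t)) := fun z => by
      rw [Real.log_prod fun t _ => (hrpos _).ne', Finset.sum_neg_distrib]
    calc ∑ z, P z * -Real.log (r z)
        = seqExp (playKernel π 0) T fun z => ∑ t, -Real.log (coinRatio i ε (z t)) := by
          simp only [hlog]; rfl
      _ = seqExp (playKernel π 0) T fun z => ∑ t, ∑ x, coinProb (0 : Fin K → ℝ) (z t).1 x *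
            -Real.log (coinRatio i ε ((z t).1, x)) := by
          rw [seqExp_sum, seqExp_sum]
          exact Finset.sum_congr rfl fun t _ =>
            seqExp_playKernel π 0 t fun z => -Real.log (coinRatio i ε z)
      _ ≤ seqExp (playKernel π 0) T fun z => 3 * ε ^ 2 * playCount i z := by
          refine seqExp_mono hq0 fun z => ?_
          rw [playCount, Finset.mul_sum]
          exact Finset.sum_le_sum fun t _ => neg_log_coinRatio_le hε0 hε i _
      _ = _ := seqExp_const_mul _ _
  have hD0 : 0 ≤ ∑ z, P z * |r z - 1| :=
    Finset.sum_nonneg fun z _ => mul_nonneg (hP z) (abs_nonneg _)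
  have hDle : ∑ z, P z * |r z - 1| ≤ 1 / 2 := by nlinarith
  -- Since r - 1 has mean 0, the count may be centred at T/2; this halves its range and yields T/4.
  have hdiff : seqExp (playKernel π (Pi.single i ε)) T (playCount i) -
      seqExp (playKernel π 0) T (playCount i) =
        ∑ z, P z * ((r z - 1) * (playCount i z - T / 2)) := by
    have h1 : ∑ z, P z * (r z - 1) = 0 := by
      simp only [mul_sub, mul_one, Finset.sum_sub_distrib, P, r, ← seqLaw_playKernel_single]
      rw [sum_seqLaw (sum_playKernel π _), sum_seqLaw (sum_playKernel π _), sub_self]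
    have h2 : ∑ z, P z * ((r z - 1) * (playCount i z - T / 2)) =
        ∑ z, P z * r z * playCount i z - ∑ z, P z * playCount i z -
          (∑ z, P z * (r z - 1)) * (T / 2) := by
      rw [Finset.sum_mul, ← Finset.sum_sub_distrib, ← Finset.sum_sub_distrib]
      exact Finset.sum_congr rfl fun z _ => by ring
    rw [h2, h1, zero_mul, sub_zero]
    simp only [seqExp, P, r, seqLaw_playKernel_single]
  have hbound : ∑ z, P z * ((r z - 1) * (playCount i z - T / 2)) ≤
      ∑ z, P z * |r z - 1| * (T / 2) := by
    refine Finset.sum_le_sum fun z _ => ?_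
    rw [mul_assoc]
    refine mul_le_mul_of_nonneg_left ((le_abs_self _).trans ?_) (hP z)
    rw [abs_mul]
    refine mul_le_mul_of_nonneg_left (abs_le.2 ⟨?_, ?_⟩) (abs_nonneg _) <;>
      linarith [playCount_nonneg i z, playCount_le i z]
  rw [← Finset.sum_mul] at hbound
  nlinarith [T.cast_nonneg (α := ℝ)]

theorem mul_le_minimaxRegret (hK : 2 ≤ K) {ε : ℝ} (hε0 : 0 ≤ ε) (hε : ε ≤ 1 / 8) {T : ℕ}
    (hT : 48 * ε ^ 2 * T ≤ K) : ε * (T / 4) ≤ minimaxRegret K d T := by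
  refine le_minimaxRegret_of_average (Nat.zero_lt_of_lt hK) fun π => ?_
  have hK' : (2 : ℝ) ≤ K := by exact_mod_cast hK
  -- The favoured action may depend on the strategy: the counts sum to T, so some action has mean
  -- count at most T/K ≤ T/2.
  obtain ⟨i, hi⟩ : ∃ i : Fin K, K * seqExp (playKernel π 0) T (playCount i) ≤ T := by
    by_contra! h
    have hsum := Finset.sum_lt_sum_of_nonempty
      (s := (Finset.univ : Finset (Fin K))) ⟨⟨0, Nat.zero_lt_of_lt hK⟩, Finset.mem_univ _⟩
      fun i _ => h i
    rw [← Finset.mul_sum, ← seqExp_sum] at hsum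
    simp only [sum_playCount, seqExp_const (sum_playKernel π 0)] at hsum
    simp at hsum
  refine ⟨Fin T → Fin K → Bool, inferInstance, _, arrayLoss, fun ω => Finset.prod_nonneg fun t _ =>
    Finset.prod_nonneg fun j _ => coinProb_single_nonneg (i := i) (by linarith) hε0 j _,
    sum_arrayLaw _ T i, le_trans ?_ (average_regret_arrayLoss π (by linarith) hε0 T i)⟩
  refine mul_le_mul_of_nonneg_left ?_ hε0
  set M := seqExp (playKernel π 0) T (playCount i)
  have hM0 : 0 ≤ M := by
    rw [← seqExp_const (sum_playKernel π 0) T 0]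
    exact seqExp_mono (playKernel_nonneg π fun j x => by
      unfold coinProb; split_ifs <;> norm_num) fun z => playCount_nonneg i z
  have h1 : 48 * ε ^ 2 * M ≤ 1 := by
    have : K * (48 * ε ^ 2 * M) ≤ K * 1 := by nlinarith [sq_nonneg ε]
    exact le_of_mul_le_mul_left this (by linarith)
  have h2 := seqExp_playCount_single_le π hε0 hε i h1
  have h3 : M ≤ T / 2 := by nlinarith
  linarith

/-- The lower bound for bandit feedback. -/
theorem min_sqrt_mul_le_minimaxRegret (hK : 2 ≤ K) (d T : ℕ) :
    1 / 32 * min (T : ℝ) √(K * T) ≤ minimaxRegret K d T := by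
  have hK' : (2 : ℝ) ≤ K := by exact_mod_cast hK
  rcases le_total T K with h | h
  · have h' : (T : ℝ) ≤ K := by exact_mod_cast h
    have := mul_le_minimaxRegret (d := d) (T := T) hK (ε := 1 / 8) (by norm_num) le_rfl
      (by linarith [T.cast_nonneg (α := ℝ)])
    linarith [min_le_left (T : ℝ) √(K * T)]
  · have h' : (K : ℝ) ≤ T := by exact_mod_cast h
    have hT : (0 : ℝ) < T := by linarith
    set S := √((K : ℝ) * T)
    have hS2 : S ^ 2 = K * T := Real.sq_sqrt (by positivity)
    have hST : S ≤ T := by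
      apply Real.sqrt_le_iff.2
      constructor <;> nlinarith
    have hS0 : 0 ≤ S := Real.sqrt_nonneg _
    have := mul_le_minimaxRegret (d := d) (T := T) hK (ε := S / (8 * T)) (by positivity)
      (by rw [div_le_iff₀ (by positivity)]; linarith)
      (by
        rw [div_pow, hS2]
        have : 48 * ((K : ℝ) * T / (8 * T) ^ 2) * T = 3 / 4 * K := by field_simp; norm_num
        linarith)
    rw [show S / (8 * T) * ((T : ℝ) / 4) = 1 / 32 * S by field_simp; ring] at this
    linarith [min_le_right (T : ℝ) S]

end BanditLowerBound

/-! ### Lower bound from the delay -/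

section DelayLowerBound

/-- The law of independent fair bits. -/
noncomputable def fairKernel (n : ℕ) (_ : Fin n → Bool) (_ : Bool) : ℝ := 1 / 2

theorem sum_fairKernel (n : ℕ) (h : Fin n → Bool) : ∑ x, fairKernel n h x = 1 := by
  simp [fairKernel]

theorem fairKernel_nonneg (n : ℕ) (h : Fin n → Bool) (x : Bool) : 0 ≤ fairKernel n h x := by
  norm_num [fairKernel]

/-- The sum of the signs encoded by `σ`. -/
noncomputable def signSum {B : ℕ} (σ : Fin B → Bool) : ℝ := ∑ b, if σ b then 1 else -1

theorem signSum_snoc {B : ℕ} (σ : Fin B → Bool) (x : Bool) :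
    signSum (Fin.snoc σ x : Fin (B + 1) → Bool) = signSum σ + if x then 1 else -1 := by
  unfold signSum
  rw [Fin.sum_univ_castSucc]
  simp only [Fin.snoc_castSucc, Fin.snoc_last]

theorem seqExp_signSum_sq (B : ℕ) : seqExp fairKernel B (fun σ => signSum σ ^ 2) = B := by
  induction B with
  | zero => simp [seqExp, signSum]
  | succ B ih =>
    rw [seqExp_succ]
    have : ∀ σ : Fin B → Bool,
        ∑ x, fairKernel B σ x * signSum (Fin.snoc σ x : Fin (B + 1) → Bool) ^ 2 =
        signSum σ ^ 2 + 1 := fun σ => by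
      simp only [Fintype.sum_bool, signSum_snoc, fairKernel, if_true, Bool.false_eq_true, if_false]
      ring
    simp only [this, seqExp_add, ih, seqExp_const sum_fairKernel]
    push_cast
    ring

theorem seqExp_signSum_pow_four (B : ℕ) :
    seqExp fairKernel B (fun σ => signSum σ ^ 4) = 3 * B ^ 2 - 2 * B := by
  induction B with
  | zero => simp [seqExp, signSum]
  | succ B ih =>
    rw [seqExp_succ]
    have : ∀ σ : Fin B → Bool,
        ∑ x, fairKernel B σ x * signSum (Fin.snoc σ x : Fin (B + 1) → Bool) ^ 4 =
        signSum σ ^ 4 + 6 * signSum σ ^ 2 + 1 := fun σ => by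
      simp only [Fintype.sum_bool, signSum_snoc, fairKernel, if_true, Bool.false_eq_true, if_false]
      ring
    simp only [this, seqExp_add, seqExp_const_mul, ih, seqExp_signSum_sq,
      seqExp_const sum_fairKernel]
    push_cast
    ring

/-- Khintchine's inequality for the first absolute moment of a sum of signs. -/
theorem sqrt_le_seqExp_abs_signSum {B : ℕ} (hB : 0 < B) :
    2 / 9 * √B ≤ seqExp fairKernel B fun σ => |signSum σ| := by
  have hB' : (0 : ℝ) < B := by exact_mod_cast hB
  have hS2 : √(B : ℝ) ^ 2 = B := Real.sq_sqrt hB'.le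
  have hS0 : 0 < √(B : ℝ) := Real.sqrt_pos.2 hB'
  set S := √(B : ℝ)
  -- The bound u ≥ u²/l - u⁴/l³ reduces the first moment to the second and fourth; l = 3√B keeps the
  -- quartic term small.
  have hpt : ∀ σ : Fin B → Bool,
      1 / (3 * S) * signSum σ ^ 2 - 1 / (3 * S) ^ 3 * signSum σ ^ 4 ≤ |signSum σ| := fun σ => by
    have hu := abs_nonneg (signSum σ)
    rw [← sq_abs, show signSum σ ^ 4 = |signSum σ| ^ 4 by
      rw [← abs_pow, abs_of_nonneg (by positivity)]]
    generalize |signSum σ| = u at hu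
    have hl : 0 < 3 * S := by positivity
    generalize 3 * S = l at hl
    have hcube : 0 ≤ l ^ 3 - u * l ^ 2 + u ^ 3 := by
      rcases le_total u l with h | h
      · nlinarith [mul_nonneg (sq_nonneg l) (sub_nonneg.2 h), pow_nonneg hu 3]
      · nlinarith [mul_nonneg (mul_nonneg hu (sub_nonneg.2 h)) (add_nonneg hu hl.le),
          pow_pos hl 3]
    have : u - (1 / l * u ^ 2 - 1 / l ^ 3 * u ^ 4) = u * (l ^ 3 - u * l ^ 2 + u ^ 3) / l ^ 3 := by
      field_simp
      ring
    have h2 : 0 ≤ u * (l ^ 3 - u * l ^ 2 + u ^ 3) / l ^ 3 := by positivity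
    linarith
  refine le_trans ?_ (seqExp_mono fairKernel_nonneg hpt)
  rw [seqExp_sub, seqExp_const_mul, seqExp_const_mul, seqExp_signSum_sq, seqExp_signSum_pow_four,
    ← hS2]
  have h1 : 1 / (3 * S) * S ^ 2 - 1 / (3 * S) ^ 3 * (3 * (S ^ 2) ^ 2 - 2 * S ^ 2) =
      2 / 9 * S + 2 / (27 * S) := by
    field_simp
    ring
  rw [h1]
  have : 0 ≤ 2 / (27 * S) := by positivity
  linarith

theorem sum_range_mul_div (B : ℕ) {L : ℕ} (hL : 0 < L) (F : ℕ → ℝ) :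
    ∑ t ∈ Finset.range (B * L), F (t / L) = L * ∑ b ∈ Finset.range B, F b := by
  induction B with
  | zero => simp
  | succ B ih =>
    rw [add_mul, one_mul, Finset.sum_range_add, ih, Finset.sum_range_succ, mul_add]
    congr 1
    rw [Finset.sum_congr rfl (g := fun _ => F B)]
    · simp
    · intro r hr
      rw [mul_comm, Nat.mul_add_div hL, Nat.div_eq_of_lt (Finset.mem_range.1 hr), add_zero]

/-- The sign of block `b`, halved, and `0` beyond the last block. -/
noncomputable def halfSign {B : ℕ} (σ : Fin B → Bool) (b : ℕ) : ℝ :=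
  if h : b < B then (if σ ⟨b, h⟩ then 1 / 2 else -(1 / 2)) else 0

theorem abs_halfSign_le {B : ℕ} (σ : Fin B → Bool) (b : ℕ) : |halfSign σ b| ≤ 1 / 2 := by
  unfold halfSign
  split_ifs <;> norm_num [abs_le]

theorem sum_halfSign {B L T : ℕ} (hL : 0 < L) (hT : B * L ≤ T) (σ : Fin B → Bool) :
    ∑ t ∈ Finset.range T, halfSign σ (t / L) = L / 2 * signSum σ := by
  rw [← Finset.sum_subset (Finset.range_mono hT), sum_range_mul_div B hL, Finset.sum_range,
    signSum, Finset.mul_sum, Finset.mul_sum]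
  · refine Finset.sum_congr rfl fun b _ => ?_
    rw [halfSign, dif_pos b.isLt]
    split_ifs <;> ring
  · intro t _ ht
    rw [halfSign, dif_neg]
    rw [Nat.div_lt_iff_lt_mul hL]
    simpa using ht

/-- Reversal of the sign of block `b`. -/
def flipAt {B : ℕ} (b : ℕ) (σ : Fin B → Bool) : Fin B → Bool :=
  fun i => if (i : ℕ) = b then !σ i else σ i

theorem flipAt_involutive {B : ℕ} (b : ℕ) : Function.Involutive (flipAt (B := B) b) := by
  intro σ
  funext i
  unfold flipAt
  split_ifs <;> simp

theorem halfSign_flipAt_self {B : ℕ} (b : ℕ) (σ : Fin B → Bool) :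
    halfSign (flipAt b σ) b = -halfSign σ b := by
  unfold halfSign flipAt
  by_cases h : b < B
  · cases hσ : σ ⟨b, h⟩ <;> simp [h, hσ]
  · simp [h]

theorem halfSign_flipAt_of_ne {B : ℕ} {b c : ℕ} (h : c ≠ b) (σ : Fin B → Bool) :
    halfSign (flipAt b σ) c = halfSign σ c := by
  simp [halfSign, flipAt, h]

theorem seqExp_fairKernel_comp_flipAt {B : ℕ} (b : ℕ) (f : (Fin B → Bool) → ℝ) :
    seqExp fairKernel B (fun σ => f (flipAt b σ)) = seqExp fairKernel B f :=
  Equiv.sum_comp (flipAt_involutive b).toPerm fun σ => seqLaw fairKernel σ * f σ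

variable {K d : ℕ}

/-- Losses constant on blocks of length `L`: in block `b` action `0` suffers the bit encoded by
the sign of the block, and the other actions the opposite bit. -/
noncomputable def blockLoss {B : ℕ} (L : ℕ) (σ : Fin B → Bool) : LossSeq K := fun t j =>
  ⟨1 / 2 + (if (j : ℕ) = 0 then 1 else -1) * halfSign σ (t / L), by
    have := abs_le.1 (abs_halfSign_le σ (t / L))
    split_ifs <;> constructor <;> linarith⟩

theorem seqExp_actionKernel_congr (π : Strategy K d) {ℓ ℓ' : LossSeq K} {t : ℕ}
    (h : ∀ s, s + d < t → ℓ s = ℓ' s) (g : Fin K → ℝ) :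
    seqExp (actionKernel π ℓ) t (fun a => ∑ j, actionKernel π ℓ t a j * g j) =
      seqExp (actionKernel π ℓ') t fun a => ∑ j, actionKernel π ℓ' t a j * g j := by
  have hk : ∀ n ≤ t, actionKernel π ℓ n = actionKernel π ℓ' n := fun n hn => by
    funext a j
    unfold actionKernel
    have : ∀ s : Fin (n - d), ℓ s = ℓ' s := fun s => h s (by omega)
    simp only [this]
  unfold seqExp seqLaw
  refine Finset.sum_congr rfl fun a _ => ?_
  rw [hk t le_rfl]
  congr 1
  exact Finset.prod_congr rfl fun s _ => by rw [hk s s.isLt.le]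

/-- Flipping the sign of the block containing round t preserves the law of the signs and all that is
observed before t, as L ≤ d+1, but turns each loss x of round t into 1 - x. -/
theorem seqExp_expectedLoss_blockLoss (π : Strategy K d) (B T : ℕ) {L : ℕ} (hL : 0 < L)
    (hLd : L ≤ d + 1) :
    seqExp fairKernel B (fun σ => expectedLoss π (blockLoss L σ) T) = T / 2 := by
  simp only [expectedLoss_eq_sum]
  rw [seqExp_sum, Finset.sum_congr rfl (g := fun _ => (1 / 2 : ℝ))]
  · simp [div_eq_mul_inv]
  intro t _
  set f : (Fin B → Bool) → ℝ := fun σ => seqExp (actionKernel π (blockLoss L σ)) t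
    fun a => ∑ j, actionKernel π (blockLoss L σ) t a j * blockLoss L σ t j with hf
  have hflip : ∀ σ, f σ + f (flipAt (t / L) σ) = 1 := by
    intro σ
    have hcongr : ∀ s, s + d < (t : ℕ) →
        (blockLoss L (flipAt (t / L) σ) s : Fin K → Set.Icc (0 : ℝ) 1) = blockLoss L σ s := by
      intro s hs
      have hne : s / L ≠ t / L := fun heq => by
        have h1 := Nat.div_add_mod s L
        have h2 := Nat.div_add_mod t L
        have h3 := Nat.mod_lt t hL
        rw [heq] at h1
        omega
      funext j
      simp only [blockLoss, halfSign_flipAt_of_ne hne]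
    have h2 : f (flipAt (t / L) σ) = seqExp (actionKernel π (blockLoss L σ)) t
        fun a => ∑ j, actionKernel π (blockLoss L σ) t a j * blockLoss L (flipAt (t / L) σ) t j :=
      seqExp_actionKernel_congr π hcongr fun j => (blockLoss L (flipAt (t / L) σ) t j : ℝ)
    rw [h2, hf, ← seqExp_add]
    refine Eq.trans ?_ (seqExp_const (sum_actionKernel π (blockLoss L σ)) t 1)
    congr 1
    funext a
    rw [← Finset.sum_add_distrib]
    refine Eq.trans ?_ (sum_actionKernel π (blockLoss L σ) t a)
    refine Finset.sum_congr rfl fun j _ => ?_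
    simp only [blockLoss, halfSign_flipAt_self]
    ring
  have hsum := seqExp_add (q := fairKernel) f fun σ => f (flipAt (t / L) σ)
  simp only [hflip, seqExp_const sum_fairKernel, seqExp_fairKernel_comp_flipAt] at hsum
  change seqExp fairKernel B f = 1 / 2
  linarith

theorem iInf_sum_blockLoss_le (hK : 2 ≤ K) {B L T : ℕ} (hL : 0 < L) (hT : B * L ≤ T)
    (σ : Fin B → Bool) :
    ⨅ i : Fin K, ∑ t ∈ Finset.range T, (blockLoss L σ t i : ℝ) ≤
      T / 2 - L / 2 * |signSum σ| := by
  have h0 := iInf_sum_loss_le (blockLoss L σ) T (⟨0, by omega⟩ : Fin K)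
  have h1 := iInf_sum_loss_le (blockLoss L σ) T (⟨1, by omega⟩ : Fin K)
  simp only [blockLoss, if_true, one_ne_zero, if_false, Finset.sum_add_distrib, ← Finset.mul_sum,
    sum_halfSign hL hT, Finset.sum_const, Finset.card_range, nsmul_eq_mul] at h0 h1 ⊢
  rcases abs_cases (signSum σ) with ⟨h, -⟩ | ⟨h, -⟩ <;> rw [h] <;> linarith

theorem mul_sqrt_le_minimaxRegret (hK : 2 ≤ K) {B L T : ℕ} (hL : 0 < L) (hLd : L ≤ d + 1)
    (hB : 0 < B) (hT : B * L ≤ T) : L * √B / 9 ≤ minimaxRegret K d T := by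
  refine le_minimaxRegret_of_average (Nat.zero_lt_of_lt hK) fun π =>
    ⟨Fin B → Bool, inferInstance, seqLaw fairKernel, blockLoss L, seqLaw_nonneg fairKernel_nonneg,
      sum_seqLaw sum_fairKernel B, ?_⟩
  change _ ≤ seqExp fairKernel B fun σ => regret π (blockLoss L σ) T
  have h1 : seqExp fairKernel B (fun σ => expectedLoss π (blockLoss L σ) T -
      (T / 2 - L / 2 * |signSum σ|)) ≤ seqExp fairKernel B fun σ => regret π (blockLoss L σ) T :=
    seqExp_mono fairKernel_nonneg fun σ => sub_le_sub_left (iInf_sum_blockLoss_le hK hL hT σ) _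
  rw [seqExp_sub, seqExp_sub, seqExp_const_mul, seqExp_const sum_fairKernel,
    seqExp_expectedLoss_blockLoss π B T hL hLd] at h1
  have h2 := mul_le_mul_of_nonneg_left (sqrt_le_seqExp_abs_signSum hB)
    (by positivity : (0 : ℝ) ≤ L / 2)
  linarith

/-- The lower bound caused by the delay. -/
theorem min_sqrt_delay_mul_le_minimaxRegret (hK : 2 ≤ K) (d T : ℕ) :
    1 / 18 * min (T : ℝ) √((d + 1) * T) ≤ minimaxRegret K d T := by
  rcases Nat.eq_zero_or_pos T with rfl | hT
  · simpa using mul_le_minimaxRegret (d := d) (T := 0) hK le_rfl (by norm_num) (by simp)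
  -- Blocks are as long as the delay permits: L is the minimum of d+1 and T. The ⌊T/L⌋ full blocks
  -- then cover at least half of the horizon.
  obtain ⟨L, hL, hLd, hLT, hmin⟩ : ∃ L : ℕ, 0 < L ∧ L ≤ d + 1 ∧ L ≤ T ∧
      min (T : ℝ) √((d + 1) * T) ≤ √(L * T) := by
    rcases le_total (d + 1) T with h | h
    · exact ⟨d + 1, by omega, le_rfl, h, by push_cast; exact min_le_right _ _⟩
    · refine ⟨T, hT, h, le_rfl, ?_⟩
      rw [Real.sqrt_mul_self T.cast_nonneg]
      exact min_le_left _ _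
  have hB : 0 < T / L := Nat.div_pos hLT hL
  refine le_trans ?_ (mul_sqrt_le_minimaxRegret hK hL hLd hB (Nat.div_mul_le_self T L))
  have hTB : (T : ℝ) ≤ 2 * ((T / L : ℕ) * L) := by
    have h1 := Nat.div_add_mod T L
    have h2 := Nat.mod_lt T hL
    have h3 : T ≤ 2 * (T / L * L) := by nlinarith
    exact_mod_cast h3
  have hsq : √((L : ℝ) * T) ≤ 2 * (L * √((T / L : ℕ) : ℝ)) := by
    apply Real.sqrt_le_iff.2
    refine ⟨by positivity, ?_⟩
    rw [mul_pow, mul_pow, Real.sq_sqrt (Nat.cast_nonneg _)]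
    have hL0 : (0 : ℝ) ≤ L := L.cast_nonneg
    nlinarith [mul_le_mul_of_nonneg_left hTB hL0, mul_nonneg hL0 (T.cast_nonneg (α := ℝ))]
  linarith

end DelayLowerBound

end DelayedBandit

theorem corollaryc :
    ∃ c C : ℝ, 0 < c ∧ 0 < C ∧ ∀ (K d T : ℕ) (hK : 2 ≤ K),
      c * min (T : ℝ) (√(((K : ℝ) + d) * T)) ≤ DelayedBandit.minimaxRegret K d T ∧
      DelayedBandit.minimaxRegret K d T ≤
        C * min (T : ℝ) (√(((K : ℝ) + d) * T * Real.log K)) ∧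
      ∃ η : ℝ, 0 < η ∧ ∀ ℓ : DelayedBandit.LossSeq K,
        DelayedBandit.regret (DelayedBandit.exp3 (Nat.zero_lt_of_lt hK) d η) ℓ T ≤
          C * ((d : ℝ) + √(((K : ℝ) + d) * T * Real.log K)) := by
  -- The two lower bounds add up to a constant 1/(32 + 18), and 1/64 is below it; 5 is the constant
  -- of `exists_regret_exp3_le`.
  refine ⟨1 / 64, 5, by norm_num, by norm_num, fun K d T hK => ?_⟩
  have hT : (0 : ℝ) ≤ T := T.cast_nonneg
  obtain ⟨η, hη, h⟩ := DelayedBandit.exists_regret_exp3_le hK d T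
  refine ⟨?_, ?_, η, hη, fun ℓ => (h ℓ).trans (by linarith [d.cast_nonneg (α := ℝ)])⟩
  · have h1 := DelayedBandit.min_sqrt_mul_le_minimaxRegret hK d T
    have h2 := DelayedBandit.min_sqrt_delay_mul_le_minimaxRegret hK d T
    have h3 : √(((K : ℝ) + d) * T) ≤ √(K * T) + √((d + 1) * T) := by
      rw [Real.sqrt_le_iff]
      refine ⟨by positivity, ?_⟩
      have hK2 := Real.sq_sqrt (by positivity : (0 : ℝ) ≤ K * T)
      have hd2 := Real.sq_sqrt (by positivity : (0 : ℝ) ≤ (d + 1) * T)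
      nlinarith [mul_nonneg (Real.sqrt_nonneg ((K : ℝ) * T)) (Real.sqrt_nonneg ((d + 1 : ℝ) * T))]
    have h4 : min (T : ℝ) √(((K : ℝ) + d) * T) ≤
        min (T : ℝ) √(K * T) + min (T : ℝ) √((d + 1) * T) := by
      have h5 := Real.sqrt_nonneg ((K : ℝ) * T)
      have h6 := Real.sqrt_nonneg ((d + 1 : ℝ) * T)
      rcases min_cases (T : ℝ) √(((K : ℝ) + d) * T) with ⟨h7, h8⟩ | ⟨h7, h8⟩ <;>
      rcases min_cases (T : ℝ) √(K * T) with ⟨h9, h10⟩ | ⟨h9, h10⟩ <;>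
      rcases min_cases (T : ℝ) √((d + 1) * T) with ⟨h11, h12⟩ | ⟨h11, h12⟩ <;>
      rw [h7, h9, h11] <;> linarith
    have h5 : 0 ≤ min (T : ℝ) √((d + 1) * T) := le_min hT (Real.sqrt_nonneg _)
    linarith
  · refine DelayedBandit.minimaxRegret_le
      (DelayedBandit.exp3 (Nat.zero_lt_of_lt hK) d η) fun ℓ => ?_
    rw [mul_min_of_nonneg _ _ (by norm_num)]
    refine le_min ?_ (h ℓ)
    linarith [DelayedBandit.regret_le_length
      (DelayedBandit.exp3 (Nat.zero_lt_of_lt hK) d η) ℓ T]
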